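/- Let $G$ be a crystallographic group of $\mathbb{R}^3$, i.e. a discrete group of Euclidean isometries containing three linearly independent translations. For a point $P\in\mathbb{R}^3$, the Dirichlet stereohedron of $G$ with base point $P$ is the closed Voronoi region $$\{X\in\mathbb{R}^3 : |X-P|\le |X-Q| \text{ for all } Q\in GP\}$$ of $P$ in the Voronoi diagram of the orbit $GP$; it is a convex polytope, and its facets are its two-dimensional faces. We say that $G$ is of one of the types below if it lies in the corresponding affine conjugacy class, i.e. if in some affine coordinate system $(x,y,z)$ of $\mathbb{R}^3$ the elements of $G$ are exactly the maps $p\mapsto w(p)+m$ with $w$ in the given list and $m$ in the lattice $L$, where $L=\mathbb{Z}^3$ for type $P$ and $L=\mathbb{Z}^3\cup(\mathbb{Z}^3+(\tfrac12,\tfrac12,\tfrac12))$ for type $I$. * $I4_1cd$ (no. 110): $(x,y,z)$, $(-x+\frac12,-y+\frac12,z+\frac12)$, $(-y,x+\frac12,z+\frac14)$, $(y+\frac12,-x,z+\frac34)$, $(x,-y,z+\frac12)$, $(-x+\frac12,y+\frac12,z)$, $(-y,-x+\frac12,z+\frac34)$, $(y+\frac12,x,z+\frac14)$. * $I\overline{4}c2$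 (no. 120): $(x,y,z)$, $(-x,-y,z)$, $(y,-x,-z)$, $(-y,x,-z)$, $(x,-y,z+\frac12)$, $(-x,y,z+\frac12)$, $(y,x,-z+\frac12)$, $(-y,-x,-z+\frac12)$. * $P\frac{4_2}{n}\frac{2}{g}\frac{2}{c}$ (no. 133, also written $P4_2/nbc$): $(x,y,z)$, $(-x+\frac12,-y+\frac12,z)$, $(-y+\frac12,x,z+\frac12)$, $(y,-x+\frac12,z+\frac12)$, $(-x+\frac12,y,-z)$, $(x,-y+\frac12,-z)$, $(y,x,-z+\frac12)$, $(-y+\frac12,-x+\frac12,-z+\frac12)$, and the negatives of these eight. * $I\frac{4_1}{g}\frac{2}{c}\frac{2}{d}$ (no. 142, also written $I4_1/acd$): $(x,y,z)$, $(-x+\frac12,-y,z+\frac12)$, $(-y+\frac14,x+\frac34,z+\frac14)$, $(y+\frac14,-x+\frac14,z+\frac34)$, $(-x+\frac12,y,-z)$, $(x,-y,-z+\frac12)$, $(y+\frac14,x+\frac34,-z+\frac34)$, $(-y+\frac14,-x+\frac14,-z+\frac14)$, and the negatives of these eight. **Proposition.** For every point $P\in\mathbb{R}^3$: 1. if $G$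 is of type $I4_1cd$, $I\overline{4}c2$ or $P\frac{4_2}{n}\frac{2}{g}\frac{2}{c}$, then the Dirichlet stereohedron of $G$ with base point $P$ has at most $44$ facets; 2. if $G$ is of type $I\frac{4_1}{g}\frac{2}{c}\frac{2}{d}$, then the Dirichlet stereohedron of $G$ with base point $P$ has at most $94$ facets. -/

import Mathlib

/-- Euclidean 3-space. -/
abbrev Space : Type := EuclideanSpace ℝ (Fin 3)

/-! ### Dirichlet stereohedra and their facets -/

/-- The orbit `GP` of a point under a group of Euclidean isometries. -/
def pointOrbit (G : Subgroup (Space ≃ᵃⁱ[ℝ] Space)) (P : Space) : Set Space :=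
  {Q | ∃ g ∈ G, g P = Q}

/-- The closed Voronoi region of the point `P` in the Voronoi diagram of the set `S`. -/
def voronoiRegion (S : Set Space) (P : Space) : Set Space :=
  {X | ∀ Q ∈ S, dist X P ≤ dist X Q}

/-- The Dirichlet stereohedron of the group `G` with base point `P`: the Voronoi region of `P`
in the Voronoi diagram of the orbit `GP`. -/
def dirichletStereohedron (G : Subgroup (Space ≃ᵃⁱ[ℝ] Space)) (P : Space) : Set Space :=
  voronoiRegion (pointOrbit G P) P

/-- `F` is a facet of the convex polyhedron `K`: a nonempty (exposed) face whose affine dimension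
is one less than that of `K`. -/
def IsFacet (K F : Set Space) : Prop :=
  F.Nonempty ∧ IsExposed ℝ K F ∧
    Module.finrank ℝ (vectorSpan ℝ F) + 1 = Module.finrank ℝ (vectorSpan ℝ K)

/-- The number of facets of `K`, as an extended natural number. -/
noncomputable def numFacets (K : Set Space) : ℕ∞ :=
  {F : Set Space | IsFacet K F}.encard

/-! ### Types (affine conjugacy classes) of crystallographic groups

A type is given, as in the crystallographic tables, in fractional coordinates `x, y, z` by
the list of its general positions modulo the lattice of translations. -/

/-- The primitive lattice `ℤ³` in fractional coordinates. -/
def latticeP : Set (Fin 3 → ℝ) :=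
  {m | ∃ n : Fin 3 → ℤ, ∀ i, m i = n i}

/-- The body-centred lattice `ℤ³ ∪ (ℤ³ + (1/2, 1/2, 1/2))` in fractional coordinates. -/
def latticeI : Set (Fin 3 → ℝ) :=
  latticeP ∪ {m | ∃ n : Fin 3 → ℤ, ∀ i, m i = n i + 1 / 2}

/-- All the maps `p ↦ w p + m`, where `w` is one of the listed general positions and `m` is a
vector of the lattice `L`. -/
def symmetryMaps (L : Set (Fin 3 → ℝ)) (W : Set (ℝ → ℝ → ℝ → Fin 3 → ℝ)) :
    Set ((Fin 3 → ℝ) → (Fin 3 → ℝ)) :=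
  {f | ∃ w ∈ W, ∃ m ∈ L, ∀ p, f p = w (p 0) (p 1) (p 2) + m}

/-- The listed positions together with their composites with the inversion at the origin. -/
def withInversion (W : Set (ℝ → ℝ → ℝ → Fin 3 → ℝ)) : Set (ℝ → ℝ → ℝ → Fin 3 → ℝ) :=
  W ∪ {w' | ∃ w ∈ W, w' = fun x y z => -w x y z}

/-- `G` belongs to the affine conjugacy class described by `S`: in a suitable affine coordinate
system `φ` of Euclidean space, the elements of `G` are exactly the maps in `S`. -/
def IsOfType (G : Subgroup (Space ≃ᵃⁱ[ℝ] Space)) (S : Set ((Fin 3 → ℝ) → (Fin 3 → ℝ))) : Prop :=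
  ∃ φ : Space ≃ᵃ[ℝ] (Fin 3 → ℝ), {f | ∃ g ∈ G, f = φ ∘ g ∘ φ.symm} = S

/-- The group `I4₁cd`, no. 110. -/
def typeI41cd : Set ((Fin 3 → ℝ) → (Fin 3 → ℝ)) :=
  symmetryMaps latticeI
    {fun x y z => ![x, y, z],
     fun x y z => ![-x + 1 / 2, -y + 1 / 2, z + 1 / 2],
     fun x y z => ![-y, x + 1 / 2, z + 1 / 4],
     fun x y z => ![y + 1 / 2, -x, z + 3 / 4],
     fun x y z => ![x, -y, z + 1 / 2],
     fun x y z => ![-x + 1 / 2, y + 1 / 2, z],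
     fun x y z => ![-y, -x + 1 / 2, z + 3 / 4],
     fun x y z => ![y + 1 / 2, x, z + 1 / 4]}

/-- The group `I-4c2`, no. 120. -/
def typeI4barc2 : Set ((Fin 3 → ℝ) → (Fin 3 → ℝ)) :=
  symmetryMaps latticeI
    {fun x y z => ![x, y, z],
     fun x y z => ![-x, -y, z],
     fun x y z => ![y, -x, -z],
     fun x y z => ![-y, x, -z],
     fun x y z => ![x, -y, z + 1 / 2],
     fun x y z => ![-x, y, z + 1 / 2],
     fun x y z => ![y, x, -z + 1 / 2],
     fun x y z => ![-y, -x, -z + 1 / 2]}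

/-- The group `P4₂/n 2/g 2/c`, no. 133 (today written `P4₂/n 2/b 2/c`), origin at a centre of inversion. -/
def typeP42nbc : Set ((Fin 3 → ℝ) → (Fin 3 → ℝ)) :=
  symmetryMaps latticeP (withInversion
    {fun x y z => ![x, y, z],
     fun x y z => ![-x + 1 / 2, -y + 1 / 2, z],
     fun x y z => ![-y + 1 / 2, x, z + 1 / 2],
     fun x y z => ![y, -x + 1 / 2, z + 1 / 2],
     fun x y z => ![-x + 1 / 2, y, -z],
     fun x y z => ![x, -y + 1 / 2, -z],
     fun x y z => ![y, x, -z + 1 / 2],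
     fun x y z => ![-y + 1 / 2, -x + 1 / 2, -z + 1 / 2]})

/-- The group `I4₁/g 2/c 2/d`, no. 142 (today written `I4₁/a 2/c 2/d`), origin at a centre of inversion. -/
def typeI41acd : Set ((Fin 3 → ℝ) → (Fin 3 → ℝ)) :=
  symmetryMaps latticeI (withInversion
    {fun x y z => ![x, y, z],
     fun x y z => ![-x + 1 / 2, -y, z + 1 / 2],
     fun x y z => ![-y + 1 / 4, x + 3 / 4, z + 1 / 4],
     fun x y z => ![y + 1 / 4, -x + 1 / 4, z + 3 / 4],
     fun x y z => ![-x + 1 / 2, y, -z],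
     fun x y z => ![x, -y, -z + 1 / 2],
     fun x y z => ![y + 1 / 4, x + 3 / 4, -z + 3 / 4],
     fun x y z => ![-y + 1 / 4, -x + 1 / 4, -z + 1 / 4]})

/-! Each of the four groups contains the planar group `pgg` acting horizontally on a unit square
cell, together with the vertical integer translations. A fourfold element makes the metric diagonal
with equal horizontal coefficients (`exists_dist_sq_eq`). An orbit therefore splits into layers:
horizontal `pgg` orbits repeated with vertical period `1`, each obtained from the layer of `P` by a
coset of `pgg` in its normalizer and a change of height.

A facet has a point `X` whose only nearest orbit points are `P` and one other point `Q`
(`facets_subset_image`), so it suffices to count such `Q`. Comparing with vertical translates shows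
that either `Q` is `P` moved vertically by `±1`, or the heights of `P` and `Q` differ by less than
`1`. In the second case comparisons inside one layer are purely planar: the projection of `X` lies
in the planar cells of both projections, each cell taken in its own `pgg` orbit. If `Q` is in the
layer of `P`, the two closed cells touch, which allows at most 14 points. Otherwise two open cells
overlap; the coset bounds the number of overlaps by 4, 5 or 7, and each family of layers occurs at
two relevant heights. The total is `2 + 14 + 2 * Σ` (`encard_neighbours_le`).

For the planar bounds (`cellBounds`), the normalizer of `pgg` moves the base point into the triangle
`0 ≤ y ≤ x ≤ 1/4`. There the cell lies in the diamond `|X - x| + |Y - y| < 1/2`, which leaves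
finitely many candidates; the superfluous ones are excluded by bisector inequalities. These are
linear in `(X, Y)` with coefficients affine in `(x, y)`, so each exclusion is a Farkas combination
with multipliers nonnegative on the triangle. -/

/-! ### Overlapping Voronoi cells of the planar group `pgg` -/

/-- The nearest-point inequalities satisfied by a point `(X, Y)` of the open planar Voronoi cell of
`(x, y)` in a `pgg` orbit, together with the diamond containing the cell. -/
structure CellIneqs (x y X Y : ℝ) : Prop where
  rot00 : 0 < x * X + y * Y
  rot10 : 0 < (x - 1 / 2) * (X - 1 / 2) + y * Y
  rot11 : 0 < (x - 1 / 2) * (X - 1 / 2) + (y - 1 / 2) * (Y - 1 / 2)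
  v00 : 0 < (X - (1 / 2 - x)) ^ 2 + (Y - (1 / 2 + y)) ^ 2 - ((X - x) ^ 2 + (Y - y) ^ 2)
  v01 : 0 < (X - (1 / 2 - x)) ^ 2 + (Y - (-1 / 2 + y)) ^ 2 - ((X - x) ^ 2 + (Y - y) ^ 2)
  h00 : 0 < (X - (1 / 2 + x)) ^ 2 + (Y - (1 / 2 - y)) ^ 2 - ((X - x) ^ 2 + (Y - y) ^ 2)
  h10 : 0 < (X - (-1 / 2 + x)) ^ 2 + (Y - (1 / 2 - y)) ^ 2 - ((X - x) ^ 2 + (Y - y) ^ 2)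
  dpp : X + Y < 1 / 2 + x + y
  dmm : -X - Y < 1 / 2 - x - y
  dpm : X - Y < 1 / 2 + x - y
  dmp : -X + Y < 1 / 2 - x + y

/-! ### The planar cell lies in a diamond. -/

section
variable {x y X Y : ℝ}

/-- The squares of `X` and `Y` cancel in each bisector inequality. Weighting by `y`, `x - y`, `1/4 -
x` and `x`, all nonnegative on the triangle, yields a linear contradiction. -/
lemma diamond_pp (h0 : 0 ≤ y) (h1 : 0 ≤ x - y) (h2 : 0 ≤ 1 / 4 - x) (hx : 0 < x)
    (rot10 : 0 < (x - 1 / 2) * (X - 1 / 2) + y * Y)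
    (v00 : 0 < (X - (1 / 2 - x)) ^ 2 + (Y - (1 / 2 + y)) ^ 2 - ((X - x) ^ 2 + (Y - y) ^ 2))
    (h00 : 0 < (X - (1 / 2 + x)) ^ 2 + (Y - (1 / 2 - y)) ^ 2 - ((X - x) ^ 2 + (Y - y) ^ 2)) :
    X + Y < 1 / 2 + x + y := by
  by_contra! h
  have h' := sub_nonneg.2 h
  linarith [mul_pos hx v00, mul_nonneg h0 h00.le, mul_nonneg h2 v00.le, mul_nonneg h1 rot10.le,
    mul_nonneg h0 v00.le, mul_nonneg h2 h', mul_nonneg h2 h00.le, mul_nonneg h0 h2]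

/-- The bisector `h11` with the glide image `(x - 1/2, -1/2 - y)` serves only here and is therefore
not a field of `CellIneqs`. -/
lemma diamond_mm (h0 : 0 ≤ y) (h1 : 0 ≤ x - y) (h2 : 0 ≤ 1 / 4 - x) (hx : 0 < x)
    (rot00 : 0 < x * X + y * Y)
    (v01 : 0 < (X - (1 / 2 - x)) ^ 2 + (Y - (-1 / 2 + y)) ^ 2 - ((X - x) ^ 2 + (Y - y) ^ 2))
    (h11 : 0 < (X - (-1 / 2 + x)) ^ 2 + (Y - (-1 / 2 - y)) ^ 2 - ((X - x) ^ 2 + (Y - y) ^ 2)) :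
    -X - Y < 1 / 2 - x - y := by
  by_contra! h
  have h' := sub_nonneg.2 h
  linarith [mul_nonneg h0 rot00.le, mul_pos hx rot00, mul_nonneg h1 h11.le, mul_nonneg h2 rot00.le,
    mul_nonneg h1 v01.le, mul_nonneg h0 h2, mul_nonneg hx.le h']

lemma diamond_pm (h0 : 0 ≤ y) (h1 : 0 ≤ x - y) (h2 : 0 ≤ 1 / 4 - x) (hx : 0 < x)
    (rot10 : 0 < (x - 1 / 2) * (X - 1 / 2) + y * Y)
    (v01 : 0 < (X - (1 / 2 - x)) ^ 2 + (Y - (-1 / 2 + y)) ^ 2 - ((X - x) ^ 2 + (Y - y) ^ 2)) :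
    X - Y < 1 / 2 + x - y := by
  by_contra! h
  have h' := sub_nonneg.2 h
  -- Substituting `X ≥ 1/2 + x - y + Y` into `v01` leaves `x * (x - y + Y) > 0`.
  have a : -(x - y) < Y := by
    by_contra! hY
    nlinarith [mul_nonneg (show 0 ≤ 1 - 4 * x by linarith) h', mul_nonneg hx.le (sub_nonneg.2 hY)]
  -- The same substitution in `rot10`; together with `a` this gives `y * (x - y) < 0`.
  have b : (1 / 2 - x - y) * Y < -((1 / 2 - x) * (x - y)) := by
    nlinarith [mul_nonneg (show 0 ≤ 1 / 2 - x by linarith) h']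
  nlinarith [mul_nonneg (show 0 ≤ 1 / 2 - x - y by linarith) (sub_nonneg.2 a.le), mul_nonneg h0 h1]

lemma diamond_mp (h0 : 0 ≤ y) (h1 : 0 ≤ x - y) (h2 : 0 ≤ 1 / 4 - x)
    (v00 : 0 < (X - (1 / 2 - x)) ^ 2 + (Y - (1 / 2 + y)) ^ 2 - ((X - x) ^ 2 + (Y - y) ^ 2))
    (h10 : 0 < (X - (-1 / 2 + x)) ^ 2 + (Y - (1 / 2 - y)) ^ 2 - ((X - x) ^ 2 + (Y - y) ^ 2)) :
    -X + Y < 1 / 2 - x + y := by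
  by_contra! h
  have a : X < 0 := by
    by_contra! hX
    nlinarith [mul_nonneg (show 0 ≤ 2 - 4 * x by linarith) hX]
  -- `h10` and `h` leave `y * (2 * Y - 1) > 0`. Then `h10` with `Y ≥ 1/2` gives `X > x - y ≥ 0`,
  -- against `a`.
  have b : 1 / 2 ≤ Y := by
    by_contra! hY
    nlinarith [mul_nonneg h0 (sub_nonneg.2 hY.le)]
  nlinarith [mul_nonneg (show 0 ≤ 1 - 4 * y by linarith) (sub_nonneg.2 b)]
lemma CellIneqs.diamond (h : CellIneqs x y X Y) :
    X + Y < 1 / 2 + x + y ∧ -X - Y < 1 / 2 - x - y ∧ X - Y < 1 / 2 + x - y ∧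
      -X + Y < 1 / 2 - x + y :=
  ⟨h.dpp, h.dmm, h.dpm, h.dmp⟩

/-! ### Coset images of the cell that can meet the cell. -/

variable {m n : ℤ}

/-- The condition `hq` is pulled back by the isometry, so both points lie in the cell of the same
`(x, y)`. Diamonds translated by `(m/2, n/2)` meet only if `|m| + |n| < 2`; `hc` removes the
translations belonging to `pgg`. -/
lemma overlap_id (hp : CellIneqs x y X Y) (hq : CellIneqs x y (X - m / 2) (Y - n / 2))
    (hc : ¬(2 ∣ m ∧ 2 ∣ n)) :
    m = -1 ∧ n = 0 ∨ m = 0 ∧ n = -1 ∨ m = 0 ∧ n = 1 ∨ m = 1 ∧ n = 0 := by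
  obtain ⟨hp1, hp2, hp3, hp4⟩ := hp.diamond
  obtain ⟨hq1, hq2, hq3, hq4⟩ := hq.diamond
  have m1 : -2 < m := by rify; linarith
  have m2 : m < 2 := by rify; linarith
  have n1 : -2 < n := by rify; linarith
  have n2 : n < 2 := by rify; linarith
  interval_cases m <;> interval_cases n <;> first
    | omega
    | (exfalso; push_cast at *; linarith)

lemma overlap_neg (h0 : 0 ≤ y) (h1 : 0 ≤ x - y) (h2 : 0 ≤ 1 / 4 - x) (hx : 0 < x)
    (hp : CellIneqs x y X Y) (hq : CellIneqs x y (-(X - m / 2)) (-(Y - n / 2)))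
    (hc : ¬(2 ∣ m ∧ 2 ∣ n)) :
    m = 0 ∧ n = 1 ∨ m = 1 ∧ n = 0 ∨ m = 1 ∧ n = 1 := by
  obtain ⟨hp1, hp2, hp3, hp4⟩ := hp.diamond
  obtain ⟨hq1, hq2, hq3, hq4⟩ := hq.diamond
  have m1 : -2 < m := by rify; linarith
  have m2 : m < 3 := by rify; linarith
  have n1 : -2 < n := by rify; linarith
  have n2 : n < 3 := by rify; linarith
  interval_cases m <;> interval_cases n <;> first
    | omega
    | (exfalso; push_cast at *; linarith)
    | (exfalso; push_cast at *; linarith [hp.rot00, hq.rot00, hp.v01, hq.v01, hp.v00, hq.v00,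
        hp.h00, hq.h00])

/-- For odd `m` and `n` the isometry is a glide reflection of `pgg` itself; this is the case removed
by `hc`. -/
lemma overlap_reflX (h0 : 0 ≤ y) (h1 : 0 ≤ x - y) (h2 : 0 ≤ 1 / 4 - x) (hx : 0 < x)
    (hp : CellIneqs x y X Y) (hq : CellIneqs x y (-(X - m / 2)) (Y - n / 2))
    (hc : ¬(¬ 2 ∣ m ∧ ¬ 2 ∣ n)) :
    m = 0 ∧ n = -1 ∨ m = 0 ∧ n = 0 ∨ m = 0 ∧ n = 1 ∨ m = 1 ∧ n = 0 ∨ m = 2 ∧ n = 0 := by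
  obtain ⟨hp1, hp2, hp3, hp4⟩ := hp.diamond
  obtain ⟨hq1, hq2, hq3, hq4⟩ := hq.diamond
  have m1 : -2 < m := by rify; linarith
  have m2 : m < 3 := by rify; linarith
  have n1 : -2 < n := by rify; linarith
  have n2 : n < 2 := by rify; linarith
  interval_cases m <;> interval_cases n <;> first
    | omega
    | (exfalso; push_cast at *; linarith)
    | (exfalso; push_cast at *; linarith [hq.rot00, mul_nonneg h0 h1,
        mul_nonneg h0 (sub_nonneg.2 hp.dmp.le), mul_nonneg h1 (sub_nonneg.2 hq.dpm.le),
        mul_pos hx (sub_pos.2 hp.dmp), hp.rot00, mul_nonneg h0 (sub_nonneg.2 hq.dmp.le)])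

lemma overlap_reflY (h0 : 0 ≤ y) (h1 : 0 ≤ x - y) (h2 : 0 ≤ 1 / 4 - x) (hx : 0 < x)
    (hp : CellIneqs x y X Y) (hq : CellIneqs x y (X - m / 2) (-(Y - n / 2)))
    (hc : ¬(¬ 2 ∣ m ∧ ¬ 2 ∣ n)) :
    m = -1 ∧ n = 0 ∨ m = 0 ∧ n = -1 ∨ m = 0 ∧ n = 0 ∨ m = 0 ∧ n = 1 ∨ m = 1 ∧ n = 0 := by
  obtain ⟨hp1, hp2, hp3, hp4⟩ := hp.diamond
  obtain ⟨hq1, hq2, hq3, hq4⟩ := hq.diamond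
  have m1 : -2 < m := by rify; linarith
  have m2 : m < 2 := by rify; linarith
  have n1 : -2 < n := by rify; linarith
  have n2 : n < 3 := by rify; linarith
  interval_cases m <;> interval_cases n <;> first
    | omega
    | (exfalso; push_cast at *; linarith)
    | (exfalso; push_cast at *; linarith [mul_nonneg h0 hp.v00.le, mul_nonneg h2 hp.v00.le,
        mul_nonneg h1 hq.h10.le, mul_nonneg h1 hp.rot11.le, mul_pos hx hq.v00,
        mul_nonneg h2 (sub_nonneg.2 hq.dmp.le)])

/-- No parity hypothesis is needed from here on: an isometry exchanging the axes never lies in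
`pgg`. -/
lemma overlap_swap (h0 : 0 ≤ y) (h1 : 0 ≤ x - y) (h2 : 0 ≤ 1 / 4 - x) (hx : 0 < x)
    (hp : CellIneqs x y X Y) (hq : CellIneqs x y (Y - n / 2) (X - m / 2)) :
    m = -1 ∧ n = 0 ∨ m = 0 ∧ n = -1 ∨ m = 0 ∧ n = 0 ∨ m = 0 ∧ n = 1 ∨ m = 1 ∧ n = -1 ∨ m = 1 ∧ n = 0 := by
  obtain ⟨hp1, hp2, hp3, hp4⟩ := hp.diamond
  obtain ⟨hq1, hq2, hq3, hq4⟩ := hq.diamond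
  have m1 : -2 < m := by rify; linarith
  have m2 : m < 3 := by rify; linarith
  have n1 : -3 < n := by rify; linarith
  have n2 : n < 2 := by rify; linarith
  interval_cases m <;> interval_cases n <;> first
    | omega
    | (exfalso; push_cast at *; linarith)

lemma overlap_negSwap (h0 : 0 ≤ y) (h1 : 0 ≤ x - y) (h2 : 0 ≤ 1 / 4 - x) (hx : 0 < x)
    (hp : CellIneqs x y X Y) (hq : CellIneqs x y (-(Y - n / 2)) (-(X - m / 2))) :
    m = 0 ∧ n = 0 ∨ m = 0 ∧ n = 1 ∨ m = 1 ∧ n = 0 ∨ m = 1 ∧ n = 1 := by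
  obtain ⟨hp1, hp2, hp3, hp4⟩ := hp.diamond
  obtain ⟨hq1, hq2, hq3, hq4⟩ := hq.diamond
  have m1 : -2 < m := by rify; linarith
  have m2 : m < 3 := by rify; linarith
  have n1 : -2 < n := by rify; linarith
  have n2 : n < 3 := by rify; linarith
  interval_cases m <;> interval_cases n <;> first
    | omega
    | (exfalso; push_cast at *; linarith)
    -- The diamonds do not exclude the remaining pairs; weighted bisector inequalities do.
    | (exfalso; push_cast at *; linarith [mul_nonneg h2 hp.rot00.le,
        mul_nonneg h1 (sub_nonneg.2 hq.dmm.le), mul_nonneg h1 hp.rot00.le, hq.rot00,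
        mul_pos hx hq.v01, mul_nonneg h0 hp.h10.le, hp.rot00, mul_nonneg h0 h1,
        mul_nonneg h0 (sub_nonneg.2 hp.dpp.le), mul_nonneg h1 (sub_nonneg.2 hq.dpm.le),
        mul_nonneg h2 hq.rot00.le])
    | (exfalso; push_cast at *; linarith [mul_nonneg h2 hp.rot00.le, mul_pos hx hp.rot00,
        mul_nonneg h1 hq.rot00.le, mul_nonneg h0 (sub_nonneg.2 hq.dpp.le),
        mul_nonneg h1 (sub_nonneg.2 hp.dpm.le), hq.rot00, mul_pos hx hp.v01, mul_nonneg h0 h1,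
        mul_nonneg h1 (sub_nonneg.2 hp.dmm.le), mul_nonneg h2 hq.rot00.le,
        mul_nonneg h0 hq.h10.le])
    | (exfalso; push_cast at *; linarith [mul_nonneg h2 hp.h00.le, hp.v00,
        mul_nonneg h0 hq.h00.le, mul_nonneg h1 hq.rot10.le, mul_nonneg h1 hq.v01.le,
        mul_nonneg h2 hq.rot11.le, mul_pos hx hq.h00])
    | (exfalso; push_cast at *; linarith [mul_nonneg h2 hq.h00.le, hq.v00,
        mul_nonneg h0 hp.h00.le, mul_nonneg h1 hp.rot10.le, mul_nonneg h1 hp.v01.le,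
        mul_nonneg h2 hp.rot11.le, mul_pos hx hp.h00])

lemma overlap_rotPos (h0 : 0 ≤ y) (h1 : 0 ≤ x - y) (h2 : 0 ≤ 1 / 4 - x) (hx : 0 < x)
    (hp : CellIneqs x y X Y) (hq : CellIneqs x y (Y - n / 2) (-(X - m / 2))) :
    m = 0 ∧ n = -1 ∨ m = 0 ∧ n = 0 ∨ m = 1 ∧ n = -1 ∨ m = 1 ∧ n = 0 := by
  obtain ⟨hp1, hp2, hp3, hp4⟩ := hp.diamond
  obtain ⟨hq1, hq2, hq3, hq4⟩ := hq.diamond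
  have m1 : -2 < m := by rify; linarith
  have m2 : m < 3 := by rify; linarith
  have n1 : -3 < n := by rify; linarith
  have n2 : n < 2 := by rify; linarith
  interval_cases m <;> interval_cases n <;> first
    | omega
    | (exfalso; push_cast at *; linarith)
    | (exfalso; push_cast at *; linarith [mul_nonneg h1 (sub_nonneg.2 hq.dmm.le),
        mul_pos hx (sub_pos.2 hq.dpm), mul_nonneg h0 (sub_nonneg.2 hq.dpm.le), hp.rot00])
    | (exfalso; push_cast at *; linarith [mul_nonneg h0 (sub_nonneg.2 hp.dmp.le),
        mul_pos hx (sub_pos.2 hp.dmp), hq.rot00, mul_nonneg h1 (sub_nonneg.2 hp.dpp.le)])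
    | (exfalso; push_cast at *; linarith [mul_nonneg h1 hq.v00.le, mul_pos hx hp.h00,
        mul_nonneg h2 hq.v00.le, mul_pos hx hq.v00, mul_nonneg h1 (sub_nonneg.2 hp.dpm.le),
        mul_nonneg h2 (sub_nonneg.2 hp.dpm.le)])
    | (exfalso; push_cast at *; linarith [mul_nonneg h0 hp.v00.le,
        mul_nonneg h1 (sub_nonneg.2 hp.dpp.le), mul_pos hx hq.h10])

lemma overlap_rotNeg (h0 : 0 ≤ y) (h1 : 0 ≤ x - y) (h2 : 0 ≤ 1 / 4 - x) (hx : 0 < x)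
    (hp : CellIneqs x y X Y) (hq : CellIneqs x y (-(Y - n / 2)) (X - m / 2)) :
    m = 0 ∧ n = 0 ∨ m = 0 ∧ n = 1 ∨ m = 1 ∧ n = 0 ∨ m = 1 ∧ n = 1 := by
  obtain ⟨hp1, hp2, hp3, hp4⟩ := hp.diamond
  obtain ⟨hq1, hq2, hq3, hq4⟩ := hq.diamond
  have m1 : -2 < m := by rify; linarith
  have m2 : m < 3 := by rify; linarith
  have n1 : -2 < n := by rify; linarith
  have n2 : n < 3 := by rify; linarith
  interval_cases m <;> interval_cases n <;> first
    | omega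
    | (exfalso; push_cast at *; linarith)
    | (exfalso; push_cast at *; linarith [mul_pos hx (sub_pos.2 hq.dmp),
        mul_nonneg h1 (sub_nonneg.2 hq.dpp.le), hp.rot00, mul_nonneg h0 (sub_nonneg.2 hq.dmp.le)])
    | (exfalso; push_cast at *; linarith [mul_pos hx (sub_pos.2 hp.dpm), hq.rot00,
        mul_nonneg h0 (sub_nonneg.2 hp.dpm.le), mul_nonneg h1 (sub_nonneg.2 hp.dmm.le)])
    | (exfalso; push_cast at *; linarith [hp.v00, mul_nonneg h2 (sub_nonneg.2 hq.dpm.le),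
        mul_nonneg h2 hp.v00.le, mul_nonneg h1 (sub_nonneg.2 hq.dpm.le), mul_nonneg h1 hp.v00.le,
        mul_pos hx hq.h00])
    | (exfalso; push_cast at *; linarith [mul_nonneg h0 hq.v00.le,
        mul_nonneg h1 (sub_nonneg.2 hq.dpp.le), mul_pos hx hp.h10])


end

/-! ### Orbits of the planar group `pgg` and its normalizer -/

/-- The squared Euclidean distance in the plane. -/
def sqd (p q : ℝ × ℝ) : ℝ := (p.1 - q.1) ^ 2 + (p.2 - q.2) ^ 2

/-- The orbit of a point under the planar group `pgg` with unit square cell and a rotation centre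
at the origin. -/
def pggOrbit (p : ℝ × ℝ) : Set (ℝ × ℝ) :=
  {q | ∃ m n : ℤ, q = (p.1 + m, p.2 + n) ∨ q = (-p.1 + m, -p.2 + n) ∨
    q = (1 / 2 - p.1 + m, 1 / 2 + p.2 + n) ∨ q = (1 / 2 + p.1 + m, 1 / 2 - p.2 + n)}

lemma sqd_pos {p q : ℝ × ℝ} (h : p ≠ q) : 0 < sqd p q := by
  rcases not_and_or.1 (mt Prod.ext_iff.2 h) with h | h
  · have := sq_pos_of_ne_zero (sub_ne_zero.2 h)
    simp only [sqd]; positivity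
  · have := sq_pos_of_ne_zero (sub_ne_zero.2 h)
    simp only [sqd]; positivity

lemma self_mem_pggOrbit (p : ℝ × ℝ) : p ∈ pggOrbit p :=
  ⟨0, 0, Or.inl (by simp)⟩

lemma pggOrbit_symm {p q : ℝ × ℝ} (h : q ∈ pggOrbit p) : p ∈ pggOrbit q := by
  obtain ⟨m, n, rfl | rfl | rfl | rfl⟩ := h
  · exact ⟨-m, -n, .inl (by ext <;> push_cast <;> ring)⟩
  · exact ⟨m, n, .inr (.inl (by ext <;> push_cast <;> ring))⟩
  · exact ⟨m, -n - 1, .inr (.inr (.inl (by ext <;> push_cast <;> ring)))⟩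
  · exact ⟨-m - 1, n, .inr (.inr (.inr (by ext <;> push_cast <;> ring)))⟩

lemma pggOrbit_trans {p q r : ℝ × ℝ} (h : q ∈ pggOrbit p) (h' : r ∈ pggOrbit q) :
    r ∈ pggOrbit p := by
  obtain ⟨m, n, rfl | rfl | rfl | rfl⟩ := h <;> obtain ⟨k, l, rfl | rfl | rfl | rfl⟩ := h'
  · exact ⟨m + k, n + l, .inl (by ext <;> push_cast <;> ring)⟩
  · exact ⟨-m + k, -n + l, .inr (.inl (by ext <;> push_cast <;> ring))⟩
  · exact ⟨-m + k, n + l, .inr (.inr (.inl (by ext <;> push_cast <;> ring)))⟩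
  · exact ⟨m + k, -n + l, .inr (.inr (.inr (by ext <;> push_cast <;> ring)))⟩
  · exact ⟨m + k, n + l, .inr (.inl (by ext <;> push_cast <;> ring))⟩
  · exact ⟨-m + k, -n + l, .inl (by ext <;> push_cast <;> ring)⟩
  · exact ⟨-m + k, n + l, .inr (.inr (.inr (by ext <;> push_cast <;> ring)))⟩
  · exact ⟨m + k, -n + l, .inr (.inr (.inl (by ext <;> push_cast <;> ring)))⟩
  · exact ⟨m + k, n + l, .inr (.inr (.inl (by ext <;> push_cast <;> ring)))⟩
  · exact ⟨-m + k - 1, -n + l - 1, .inr (.inr (.inr (by ext <;> push_cast <;> ring)))⟩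
  · exact ⟨-m + k, n + l + 1, .inl (by ext <;> push_cast <;> ring)⟩
  · exact ⟨m + k + 1, -n + l, .inr (.inl (by ext <;> push_cast <;> ring))⟩
  · exact ⟨m + k, n + l, .inr (.inr (.inr (by ext <;> push_cast <;> ring)))⟩
  · exact ⟨-m + k - 1, -n + l - 1, .inr (.inr (.inl (by ext <;> push_cast <;> ring)))⟩
  · exact ⟨-m + k, n + l + 1, .inr (.inl (by ext <;> push_cast <;> ring))⟩
  · exact ⟨m + k + 1, -n + l, .inl (by ext <;> push_cast <;> ring)⟩

lemma pggOrbit_eq {p q : ℝ × ℝ} (h : q ∈ pggOrbit p) : pggOrbit q = pggOrbit p :=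
  Set.ext fun _ => ⟨pggOrbit_trans h, pggOrbit_trans (pggOrbit_symm h)⟩

/-- `ν` is a Euclidean isometry of the plane normalizing `pgg`. -/
structure NormalizesPgg (ν : ℝ × ℝ ≃ ℝ × ℝ) : Prop where
  sqd_eq : ∀ p q, sqd (ν p) (ν q) = sqd p q
  mem_iff : ∀ p q, ν q ∈ pggOrbit (ν p) ↔ q ∈ pggOrbit p

namespace NormalizesPgg

lemma of_forall {ν : ℝ × ℝ ≃ ℝ × ℝ} (h : ∀ p q, sqd (ν p) (ν q) = sqd p q)
    (h1 : ∀ p, ∀ q ∈ pggOrbit p, ν q ∈ pggOrbit (ν p))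
    (h2 : ∀ p, ∀ q ∈ pggOrbit p, ν.symm q ∈ pggOrbit (ν.symm p)) : NormalizesPgg ν :=
  ⟨h, fun p q => ⟨fun hq => by simpa using h2 _ _ hq, h1 p q⟩⟩

lemma trans {ν μ : ℝ × ℝ ≃ ℝ × ℝ} (hν : NormalizesPgg ν) (hμ : NormalizesPgg μ) :
    NormalizesPgg (ν.trans μ) :=
  ⟨fun p q => by simp [hμ.sqd_eq, hν.sqd_eq], fun p q => by simp [hμ.mem_iff, hν.mem_iff]⟩

lemma symm {ν : ℝ × ℝ ≃ ℝ × ℝ} (hν : NormalizesPgg ν) : NormalizesPgg ν.symm :=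
  ⟨fun p q => by rw [← hν.sqd_eq]; simp, fun p q => by rw [← hν.mem_iff]; simp⟩

end NormalizesPgg

/-- Translation by `(m / 2, n / 2)`. -/
@[simps]
noncomputable def halfShift (m n : ℤ) : ℝ × ℝ ≃ ℝ × ℝ where
  toFun p := (p.1 + m / 2, p.2 + n / 2)
  invFun p := (p.1 - m / 2, p.2 - n / 2)
  left_inv p := by simp
  right_inv p := by simp

/-- The reflection changing the sign of the first coordinate. -/
@[simps]
def reflX : ℝ × ℝ ≃ ℝ × ℝ where
  toFun p := (-p.1, p.2)
  invFun p := (-p.1, p.2)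
  left_inv p := by simp
  right_inv p := by simp

/-- The reflection changing the sign of the second coordinate. -/
@[simps]
def reflY : ℝ × ℝ ≃ ℝ × ℝ where
  toFun p := (p.1, -p.2)
  invFun p := (p.1, -p.2)
  left_inv p := by simp
  right_inv p := by simp

lemma pggOrbit_halfShift (m n : ℤ) (p q : ℝ × ℝ) (h : q ∈ pggOrbit p) :
    halfShift m n q ∈ pggOrbit (halfShift m n p) := by
  obtain ⟨k, l, rfl | rfl | rfl | rfl⟩ := h
  · exact ⟨k, l, .inl (by ext <;> simp <;> ring)⟩
  · exact ⟨k + m, l + n, .inr (.inl (by ext <;> simp <;> ring))⟩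
  · exact ⟨k + m, l, .inr (.inr (.inl (by ext <;> simp <;> ring)))⟩
  · exact ⟨k, l + n, .inr (.inr (.inr (by ext <;> simp <;> ring)))⟩

lemma halfShift_symm (m n : ℤ) : (halfShift m n).symm = halfShift (-m) (-n) := by
  ext p <;> simp <;> ring

lemma normalizesPgg_halfShift (m n : ℤ) : NormalizesPgg (halfShift m n) :=
  .of_forall (fun p q => by simp only [sqd, halfShift_apply]; ring) (pggOrbit_halfShift m n)
    (by rw [halfShift_symm]; exact pggOrbit_halfShift _ _)

lemma normalizesPgg_reflX : NormalizesPgg reflX := by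
  have h : ∀ p, ∀ q ∈ pggOrbit p, reflX q ∈ pggOrbit (reflX p) := by
    rintro p q ⟨k, l, rfl | rfl | rfl | rfl⟩
    · exact ⟨-k, l, .inl (by ext <;> simp <;> ring)⟩
    · exact ⟨-k, l, .inr (.inl (by ext <;> simp <;> ring))⟩
    · exact ⟨-k - 1, l, .inr (.inr (.inl (by ext <;> simp <;> ring)))⟩
    · exact ⟨-k - 1, l, .inr (.inr (.inr (by ext <;> simp <;> ring)))⟩
  exact .of_forall (fun p q => by simp only [sqd, reflX_apply]; ring) h h

lemma normalizesPgg_swap : NormalizesPgg (Equiv.prodComm ℝ ℝ) := by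
  have h : ∀ p, ∀ q ∈ pggOrbit p, Equiv.prodComm ℝ ℝ q ∈ pggOrbit (Equiv.prodComm ℝ ℝ p) := by
    rintro p q ⟨k, l, rfl | rfl | rfl | rfl⟩
    · exact ⟨l, k, .inl (by ext <;> simp)⟩
    · exact ⟨l, k, .inr (.inl (by ext <;> simp))⟩
    · exact ⟨l, k, .inr (.inr (.inr (by ext <;> simp)))⟩
    · exact ⟨l, k, .inr (.inr (.inl (by ext <;> simp)))⟩
  exact .of_forall (fun p q => by simp [sqd]; ring) h h

lemma normalizesPgg_reflY : NormalizesPgg reflY := by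
  have : reflY = ((Equiv.prodComm ℝ ℝ).trans reflX).trans (Equiv.prodComm ℝ ℝ) := by
    ext p <;> simp
  rw [this]
  exact (normalizesPgg_swap.trans normalizesPgg_reflX).trans normalizesPgg_swap

lemma normalizesPgg_neg : NormalizesPgg (Equiv.neg (ℝ × ℝ)) := by
  have : Equiv.neg (ℝ × ℝ) = reflX.trans reflY := by ext p <;> simp
  rw [this]
  exact normalizesPgg_reflX.trans normalizesPgg_reflY

/-! ### Planar Voronoi cells -/

/-- `X` lies in the open Voronoi cell of `p` in its `pgg` orbit. -/
def InCell (p X : ℝ × ℝ) : Prop := ∀ r ∈ pggOrbit p, r ≠ p → sqd X p < sqd X r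

/-- `X` lies in the closed Voronoi cell of `p` in its `pgg` orbit. -/
def InClosedCell (p X : ℝ × ℝ) : Prop := ∀ r ∈ pggOrbit p, sqd X p ≤ sqd X r

/-- The difference of the squared distances to `r` and `p` is affine along the segment, positive at
`p` and nonnegative at `X`. -/
lemma InClosedCell.lineMap {p X : ℝ × ℝ} (h : InClosedCell p X) {t : ℝ} (h0 : 0 ≤ t) (h1 : t < 1) :
    InCell p (p.1 + t * (X.1 - p.1), p.2 + t * (X.2 - p.2)) := by
  intro r hr hrp
  have a := mul_nonneg h0 (sub_nonneg.2 (h r hr))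
  have b := mul_pos (sub_pos.2 h1) (sqd_pos hrp)
  simp only [sqd] at *
  nlinarith

namespace NormalizesPgg

variable {ν : ℝ × ℝ ≃ ℝ × ℝ} {p X : ℝ × ℝ}

lemma inCell (hν : NormalizesPgg ν) (h : InCell p X) : InCell (ν p) (ν X) := by
  intro r hr hne
  obtain ⟨s, rfl⟩ := ν.surjective r
  rw [hν.sqd_eq, hν.sqd_eq]
  exact h s ((hν.mem_iff _ _).1 hr) fun e => hne (by rw [e])

lemma inClosedCell (hν : NormalizesPgg ν) (h : InClosedCell p X) :
    InClosedCell (ν p) (ν X) := by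
  intro r hr
  obtain ⟨s, rfl⟩ := ν.surjective r
  rw [hν.sqd_eq, hν.sqd_eq]
  exact h s ((hν.mem_iff _ _).1 hr)

lemma inCell_symm (hν : NormalizesPgg ν) (h : InCell (ν p) X) : InCell p (ν.symm X) := by
  simpa using hν.symm.inCell h

lemma inClosedCell_symm (hν : NormalizesPgg ν) (h : InClosedCell (ν p) X) :
    InClosedCell p (ν.symm X) := by
  simpa using hν.symm.inClosedCell h

lemma inCell_iff (hν : NormalizesPgg ν) : InCell (ν p) (ν X) ↔ InCell p X :=
  ⟨fun h => by simpa using hν.inCell_symm h, hν.inCell⟩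

lemma inClosedCell_iff (hν : NormalizesPgg ν) :
    InClosedCell (ν p) (ν X) ↔ InClosedCell p X :=
  ⟨fun h => by simpa using hν.inClosedCell_symm h, hν.inClosedCell⟩

end NormalizesPgg

/-- The points of the orbit of `p'` whose open Voronoi cells meet that of `p`. -/
def overlapSet (p p' : ℝ × ℝ) : Set (ℝ × ℝ) :=
  {q | q ∈ pggOrbit p' ∧ ∃ X, InCell p X ∧ InCell q X}

/-- The other points of the orbit of `p` whose closed Voronoi cells meet that of `p`. -/
def contactSet (p : ℝ × ℝ) : Set (ℝ × ℝ) :=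
  {q | q ∈ pggOrbit p ∧ q ≠ p ∧ ∃ X, InClosedCell p X ∧ InClosedCell q X}

lemma NormalizesPgg.encard_overlapSet {ν : ℝ × ℝ ≃ ℝ × ℝ} (hν : NormalizesPgg ν)
    (p p' : ℝ × ℝ) : (overlapSet (ν p) (ν p')).encard = (overlapSet p p').encard := by
  rw [← ν.injective.encard_image (overlapSet p p')]
  congr 1
  ext q
  obtain ⟨q, rfl⟩ := ν.surjective q
  rw [ν.injective.mem_set_image]
  exact and_congr (hν.mem_iff _ _) (ν.surjective.exists.trans
    (exists_congr fun X => and_congr hν.inCell_iff hν.inCell_iff))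

lemma NormalizesPgg.encard_contactSet {ν : ℝ × ℝ ≃ ℝ × ℝ} (hν : NormalizesPgg ν)
    (p : ℝ × ℝ) : (contactSet (ν p)).encard = (contactSet p).encard := by
  rw [← ν.injective.encard_image (contactSet p)]
  congr 1
  ext q
  obtain ⟨q, rfl⟩ := ν.surjective q
  rw [ν.injective.mem_set_image]
  exact and_congr (hν.mem_iff _ _) (and_congr ν.injective.ne_iff (ν.surjective.exists.trans
    (exists_congr fun X => and_congr hν.inClosedCell_iff hν.inClosedCell_iff)))

/-! ### Bounds for overlapping and touching cells of `pgg` orbits -/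

lemma Set.encard_le_length {α : Type*} {S : Set α} {l : List α} (h : ∀ q ∈ S, q ∈ l) :
    S.encard ≤ l.length := by
  classical
  calc S.encard ≤ (l.toFinset : Set α).encard :=
        Set.encard_le_encard fun q hq => by simpa using h q hq
    _ = l.toFinset.card := Set.encard_coe_eq_coe_finsetCard _
    _ ≤ l.length := by exact_mod_cast l.toFinset_card_le

/-- The fundamental triangle for the normalizer of `pgg`. -/
structure InTriangle (p : ℝ × ℝ) : Prop where
  nonneg : 0 ≤ p.2
  le : 0 ≤ p.1 - p.2
  le_quarter : 0 ≤ 1 / 4 - p.1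

lemma InCell.cellIneqs {p X : ℝ × ℝ} (hp : InTriangle p) (hx : 0 < p.1) (h : InCell p X) :
    CellIneqs p.1 p.2 X.1 X.2 := by
  obtain ⟨h0, h1, h2⟩ := hp
  obtain ⟨x, y⟩ := p
  obtain ⟨X, Y⟩ := X
  dsimp only at *
  have rot (m n : ℤ) (hm : -x + m ≠ x) :
      (X - x) ^ 2 + (Y - y) ^ 2 < (X - (-x + m)) ^ 2 + (Y - (-y + n)) ^ 2 :=
    h (-x + m, -y + n) ⟨m, n, .inr (.inl rfl)⟩ fun e => hm (congrArg Prod.fst e)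
  have vert (m n : ℤ) : (X - x) ^ 2 + (Y - y) ^ 2 <
      (X - (1 / 2 - x + m)) ^ 2 + (Y - (1 / 2 + y + n)) ^ 2 :=
    h (1 / 2 - x + m, 1 / 2 + y + n) ⟨m, n, .inr (.inr (.inl rfl))⟩ fun e => by
      have e : 1 / 2 + y + n = y := congrArg Prod.snd e
      have e : ((2 * n + 1 : ℤ) : ℝ) = (0 : ℤ) := by push_cast; linarith
      have := Int.cast_injective e
      omega
  have horiz (m n : ℤ) : (X - x) ^ 2 + (Y - y) ^ 2 <
      (X - (1 / 2 + x + m)) ^ 2 + (Y - (1 / 2 - y + n)) ^ 2 :=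
    h (1 / 2 + x + m, 1 / 2 - y + n) ⟨m, n, .inr (.inr (.inr rfl))⟩ fun e => by
      have e : 1 / 2 + x + m = x := congrArg Prod.fst e
      have e : ((2 * m + 1 : ℤ) : ℝ) = (0 : ℤ) := by push_cast; linarith
      have := Int.cast_injective e
      omega
  -- Since `0 < x ≤ 1/4`, `2 * x` is neither `0` nor `1`, so these half-turns move `p`.
  have r00 := rot 0 0 (by push_cast; linarith)
  have r10 := rot 1 0 (by push_cast; linarith)
  have r11 := rot 1 1 (by push_cast; linarith)
  have v00 := vert 0 0
  have v01 := vert 0 (-1)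
  have w00 := horiz 0 0
  have w10 := horiz (-1) 0
  have w11 := horiz (-1) (-1)
  push_cast at r00 r10 r11 v00 v01 w00 w10 w11
  have rot00 : 0 < x * X + y * Y := by linarith
  have rot10 : 0 < (x - 1 / 2) * (X - 1 / 2) + y * Y := by linarith
  have v00' : 0 < (X - (1 / 2 - x)) ^ 2 + (Y - (1 / 2 + y)) ^ 2 - ((X - x) ^ 2 + (Y - y) ^ 2) := by
    linarith
  have v01' : 0 < (X - (1 / 2 - x)) ^ 2 + (Y - (-1 / 2 + y)) ^ 2 - ((X - x) ^ 2 + (Y - y) ^ 2) := by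
    linarith
  have h00' : 0 < (X - (1 / 2 + x)) ^ 2 + (Y - (1 / 2 - y)) ^ 2 - ((X - x) ^ 2 + (Y - y) ^ 2) := by
    linarith
  have h10' : 0 < (X - (-1 / 2 + x)) ^ 2 + (Y - (1 / 2 - y)) ^ 2 - ((X - x) ^ 2 + (Y - y) ^ 2) := by
    linarith
  exact ⟨rot00, rot10, by linarith, v00', v01', h00', h10',
    diamond_pp h0 h1 h2 hx rot10 v00' h00', diamond_mm h0 h1 h2 hx rot00 v01' (by linarith),
    diamond_pm h0 h1 h2 hx rot10 v01', diamond_mp h0 h1 h2 v00' h10'⟩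

/-- `X` lies in the open square of half-diagonal `1 / 2` around `p`. -/
def InDiamond (p X : ℝ × ℝ) : Prop :=
  X.1 + X.2 < 1 / 2 + p.1 + p.2 ∧ -X.1 - X.2 < 1 / 2 - p.1 - p.2 ∧
    X.1 - X.2 < 1 / 2 + p.1 - p.2 ∧ -X.1 + X.2 < 1 / 2 - p.1 + p.2

lemma InTriangle.eq_zero {p : ℝ × ℝ} (hp : InTriangle p) (hx : ¬0 < p.1) : p = 0 := by
  obtain ⟨h0, h1, -⟩ := hp
  ext <;> simp <;> linarith

lemma InCell.inDiamond {p X : ℝ × ℝ} (hp : InTriangle p) (h : InCell p X) : InDiamond p X := by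
  by_cases hx : 0 < p.1
  · exact (h.cellIneqs hp hx).diamond
  -- At the origin, a rotation centre, the half-turn bisector degenerates; the four images `(±1/2,
  -- ±1/2)` alone cut out the diamond.
  obtain rfl := hp.eq_zero hx
  obtain ⟨X, Y⟩ := X
  have key (m n : ℤ) : X ^ 2 + Y ^ 2 < (X - (1 / 2 + m)) ^ 2 + (Y - (1 / 2 + n)) ^ 2 := by
    have := h (1 / 2 + m, 1 / 2 + n) ⟨m, n, .inr (.inr (.inl (by simp)))⟩ fun e => by
      have e : (1 / 2 + m : ℝ) = 0 := congrArg Prod.fst e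
      have e : ((2 * m + 1 : ℤ) : ℝ) = (0 : ℤ) := by push_cast; linarith
      have := Int.cast_injective e
      omega
    simpa [sqd] using this
  have a := key 0 0
  have b := key 0 (-1)
  have c := key (-1) 0
  have d := key (-1) (-1)
  push_cast at a b c d
  refine ⟨?_, ?_, ?_, ?_⟩ <;> simp <;> linarith

/-- Shrinking towards `p` enters the open cell, hence the open diamond; letting the ratio tend to
`1` gives the weak inequalities. -/
lemma InClosedCell.diamond_le {p X : ℝ × ℝ} (hp : InTriangle p) (h : InClosedCell p X) :
    X.1 + X.2 ≤ 1 / 2 + p.1 + p.2 ∧ -X.1 - X.2 ≤ 1 / 2 - p.1 - p.2 ∧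
      X.1 - X.2 ≤ 1 / 2 + p.1 - p.2 ∧ -X.1 + X.2 ≤ 1 / 2 - p.1 + p.2 := by
  have key (s : ℝ) (hs : ∀ t : ℝ, 0 ≤ t → t < 1 → t * s < 1 / 2) : s ≤ 1 / 2 := by
    by_contra! h
    have h1 := hs (1 / (2 * s)) (by positivity) (by rw [div_lt_one (by positivity)]; linarith)
    rw [div_mul_eq_mul_div, div_lt_div_iff₀ (by positivity) (by norm_num)] at h1
    linarith
  have hd (t : ℝ) (h0 : 0 ≤ t) (h1 : t < 1) := (h.lineMap h0 h1).inDiamond hp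
  refine ⟨?_, ?_, ?_, ?_⟩
  · linarith [key (X.1 + X.2 - p.1 - p.2) fun t h0 h1 => by
      have := (hd t h0 h1).1
      dsimp only at this
      linarith]
  · linarith [key (-X.1 - X.2 + p.1 + p.2) fun t h0 h1 => by
      have := (hd t h0 h1).2.1
      dsimp only at this
      linarith]
  · linarith [key (X.1 - X.2 - p.1 + p.2) fun t h0 h1 => by
      have := (hd t h0 h1).2.2.1
      dsimp only at this
      linarith]
  · linarith [key (-X.1 + X.2 + p.1 - p.2) fun t h0 h1 => by
      have := (hd t h0 h1).2.2.2
      dsimp only at this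
      linarith]

lemma halfShift_zero_zero (p : ℝ × ℝ) : halfShift 0 0 p = p := by
  ext <;> simp

/-- This sorts a coset by linear part. Glides carry an extra `(1/2, 1/2)`, hence the parity shift by
`1` in the two reflected cases. -/
lemma exists_halfShift_of_mem_pggOrbit {a b : ℤ} {p q : ℝ × ℝ}
    (h : q ∈ pggOrbit (halfShift a b p)) :
    ∃ m n : ℤ, q = halfShift m n p ∧ 2 ∣ m - a ∧ 2 ∣ n - b ∨
      q = halfShift m n (-p) ∧ 2 ∣ m - a ∧ 2 ∣ n - b ∨
      q = halfShift m n (reflX p) ∧ 2 ∣ m - a - 1 ∧ 2 ∣ n - b - 1 ∨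
      q = halfShift m n (reflY p) ∧ 2 ∣ m - a - 1 ∧ 2 ∣ n - b - 1 := by
  obtain ⟨m, n, rfl | rfl | rfl | rfl⟩ := h
  · exact ⟨a + 2 * m, b + 2 * n, .inl ⟨by ext <;> simp <;> ring, by omega, by omega⟩⟩
  · exact ⟨-a + 2 * m, -b + 2 * n, .inr (.inl ⟨by ext <;> simp <;> ring, by omega, by omega⟩)⟩
  · exact ⟨1 - a + 2 * m, 1 + b + 2 * n, .inr (.inr (.inl
      ⟨by ext <;> simp <;> ring, by omega, by omega⟩))⟩
  · exact ⟨1 + a + 2 * m, 1 - b + 2 * n, .inr (.inr (.inr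
      ⟨by ext <;> simp <;> ring, by omega, by omega⟩))⟩

/-- The representative of a coset of `pgg` in its normalizer, applied to a point. -/
noncomputable def cosetRep (s : Bool) (a b : ℤ) (p : ℝ × ℝ) : ℝ × ℝ :=
  halfShift a b (bif s then p.swap else p)

/-- A bound on the number of cells of the orbit of `cosetRep s a b p` meeting the cell of `p`. -/
def overlapBound (s : Bool) (a b : ℤ) : ℕ∞ :=
  if 2 ∣ a + b then if s = false ∧ 2 ∣ a then ⊤ else 4 else bif s then 5 else 7

/-- All four linear parts fix the origin, so only the translation remains, and only the parity of `m
+ n` is prescribed. -/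
lemma encard_overlapSet_zero (a b : ℤ) : (overlapSet 0 (halfShift a b 0)).encard ≤ 4 := by
  have tri : InTriangle 0 := ⟨by simp, by simp, by simp⟩
  have key : ∀ q ∈ overlapSet 0 (halfShift a b 0), ∃ m n : ℤ, q = halfShift m n 0 ∧
      2 ∣ m + n - a - b ∧ (m + n < 2 ∧ -2 < m + n ∧ m - n < 2 ∧ -2 < m - n) := by
    rintro q ⟨hq, X, h1, h2⟩
    obtain ⟨m, n, h⟩ := exists_halfShift_of_mem_pggOrbit hq
    have hq' : q = halfShift m n 0 ∧ 2 ∣ m + n - a - b := by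
      rcases h with ⟨rfl, _, _⟩ | ⟨rfl, _, _⟩ | ⟨rfl, _, _⟩ | ⟨rfl, _, _⟩ <;>
        exact ⟨by simp, by omega⟩
    obtain ⟨rfl, hmn⟩ := hq'
    obtain ⟨a1, a2, a3, a4⟩ := h1.inDiamond tri
    obtain ⟨b1, b2, b3, b4⟩ := ((normalizesPgg_halfShift m n).inCell_symm h2).inDiamond tri
    simp at a1 a2 a3 a4 b1 b2 b3 b4
    refine ⟨m, n, rfl, hmn, ?_, ?_, ?_, ?_⟩ <;> rify <;> linarith
  by_cases hab : 2 ∣ a + b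
  · refine (Set.encard_le_length (l := [halfShift 0 0 0]) ?_).trans (by simp)
    intro q hq
    obtain ⟨m, n, rfl, h, h'⟩ := key q hq
    obtain ⟨rfl, rfl⟩ : m = 0 ∧ n = 0 := by omega
    simp
  · refine (Set.encard_le_length (l := [halfShift 1 0 0, halfShift (-1) 0 0, halfShift 0 1 0,
      halfShift 0 (-1) 0]) ?_).trans (by simp)
    intro q hq
    obtain ⟨m, n, rfl, h, h'⟩ := key q hq
    obtain ⟨rfl, rfl⟩ | ⟨rfl, rfl⟩ | ⟨rfl, rfl⟩ | ⟨rfl, rfl⟩ :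
      m = 1 ∧ n = 0 ∨ m = -1 ∧ n = 0 ∨ m = 0 ∧ n = 1 ∨ m = 0 ∧ n = -1 := by omega
    all_goals simp only [List.mem_cons, true_or, or_true]

lemma encard_contactSet_zero : (contactSet 0).encard ≤ 14 := by
  have tri : InTriangle 0 := ⟨by simp, by simp, by simp⟩
  refine (Set.encard_le_length (l := [halfShift 2 0 0, halfShift (-2) 0 0, halfShift 0 2 0,
      halfShift 0 (-2) 0, halfShift 1 1 0, halfShift 1 (-1) 0, halfShift (-1) 1 0,
      halfShift (-1) (-1) 0]) ?_).trans (by norm_num)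
  rintro q ⟨hq, hq0, X, h1, h2⟩
  obtain ⟨m, n, h⟩ := exists_halfShift_of_mem_pggOrbit (a := 0) (b := 0) (p := 0)
    (by rwa [halfShift_zero_zero])
  have hq' : q = halfShift m n 0 ∧ 2 ∣ m + n := by
    rcases h with ⟨rfl, _, _⟩ | ⟨rfl, _, _⟩ | ⟨rfl, _, _⟩ | ⟨rfl, _, _⟩ <;>
      exact ⟨by simp, by omega⟩
  obtain ⟨rfl, hmn⟩ := hq'
  have h0 : ¬(m = 0 ∧ n = 0) := by
    rintro ⟨rfl, rfl⟩
    exact hq0 (by ext <;> simp)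
  obtain ⟨a1, a2, a3, a4⟩ := h1.diamond_le tri
  obtain ⟨b1, b2, b3, b4⟩ := ((normalizesPgg_halfShift m n).inClosedCell_symm h2).diamond_le tri
  simp at a1 a2 a3 a4 b1 b2 b3 b4
  have c1 : m + n ≤ 2 := by rify; linarith
  have c2 : -2 ≤ m + n := by rify; linarith
  have c3 : m - n ≤ 2 := by rify; linarith
  have c4 : -2 ≤ m - n := by rify; linarith
  obtain ⟨rfl, rfl⟩ | ⟨rfl, rfl⟩ | ⟨rfl, rfl⟩ | ⟨rfl, rfl⟩ | ⟨rfl, rfl⟩ | ⟨rfl, rfl⟩ |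
      ⟨rfl, rfl⟩ | ⟨rfl, rfl⟩ :
    m = 2 ∧ n = 0 ∨ m = -2 ∧ n = 0 ∨ m = 0 ∧ n = 2 ∨ m = 0 ∧ n = -2 ∨ m = 1 ∧ n = 1 ∨
      m = 1 ∧ n = -1 ∨ m = -1 ∧ n = 1 ∨ m = -1 ∧ n = -1 := by omega
  all_goals simp only [List.mem_cons, true_or, or_true]

lemma encard_overlapSet_of_triangle {p : ℝ × ℝ} (hp : InTriangle p) (s : Bool) (a b : ℤ) :
    (overlapSet p (cosetRep s a b p)).encard ≤ overlapBound s a b := by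
  by_cases hx : 0 < p.1
  swap
  · obtain rfl := hp.eq_zero hx
    have h := encard_overlapSet_zero a b
    have h' : cosetRep s a b 0 = halfShift a b 0 := by cases s <;> rfl
    rw [h', overlapBound]
    refine h.trans ?_
    split_ifs
    · exact le_top
    · exact le_rfl
    · cases s <;> norm_num
  have cell {X : ℝ × ℝ} (h : InCell p X) := h.cellIneqs hp hx
  obtain ⟨t0, t1, t2⟩ := hp
  have shift (m n : ℤ) := normalizesPgg_halfShift m n
  cases s
  · by_cases hab : 2 ∣ a ∧ 2 ∣ b
    · rw [overlapBound, if_pos (by omega), if_pos ⟨rfl, hab.1⟩]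
      exact le_top
    -- Candidates for all nontrivial cosets at once; the parities of `a` and `b` then select those
    -- of the given coset.
    have key : ∀ q ∈ overlapSet p (cosetRep false a b p), ∃ m n : ℤ,
        (q = halfShift m n p ∧ (2 ∣ m - a ∧ 2 ∣ n - b) ∧
          (m = -1 ∧ n = 0 ∨ m = 0 ∧ n = -1 ∨ m = 0 ∧ n = 1 ∨ m = 1 ∧ n = 0)) ∨
        (q = halfShift m n (-p) ∧ (2 ∣ m - a ∧ 2 ∣ n - b) ∧
          (m = 0 ∧ n = 1 ∨ m = 1 ∧ n = 0 ∨ m = 1 ∧ n = 1)) ∨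
        (q = halfShift m n (reflX p) ∧ (2 ∣ m - a - 1 ∧ 2 ∣ n - b - 1) ∧
          (m = 0 ∧ n = -1 ∨ m = 0 ∧ n = 0 ∨ m = 0 ∧ n = 1 ∨ m = 1 ∧ n = 0 ∨ m = 2 ∧ n = 0)) ∨
        (q = halfShift m n (reflY p) ∧ (2 ∣ m - a - 1 ∧ 2 ∣ n - b - 1) ∧
          (m = -1 ∧ n = 0 ∨ m = 0 ∧ n = -1 ∨ m = 0 ∧ n = 0 ∨ m = 0 ∧ n = 1 ∨
            m = 1 ∧ n = 0)) := by
      rintro q ⟨hq, X, h1, h2⟩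
      obtain ⟨m, n, ⟨rfl, e1, e2⟩ | ⟨rfl, e1, e2⟩ | ⟨rfl, e1, e2⟩ | ⟨rfl, e1, e2⟩⟩ :=
        exists_halfShift_of_mem_pggOrbit hq
      · exact ⟨m, n, .inl ⟨rfl, ⟨e1, e2⟩,
          overlap_id (cell h1) (cell ((shift m n).inCell_symm h2)) (by omega)⟩⟩
      · exact ⟨m, n, .inr (.inl ⟨rfl, ⟨e1, e2⟩, overlap_neg t0 t1 t2 hx (cell h1)
          (cell ((normalizesPgg_neg.trans (shift m n)).inCell_symm h2)) (by omega)⟩)⟩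
      · exact ⟨m, n, .inr (.inr (.inl ⟨rfl, ⟨e1, e2⟩, overlap_reflX t0 t1 t2 hx (cell h1)
          (cell ((normalizesPgg_reflX.trans (shift m n)).inCell_symm h2)) (by omega)⟩))⟩
      · exact ⟨m, n, .inr (.inr (.inr ⟨rfl, ⟨e1, e2⟩, overlap_reflY t0 t1 t2 hx (cell h1)
          (cell ((normalizesPgg_reflY.trans (shift m n)).inCell_symm h2)) (by omega)⟩))⟩
    by_cases ha : 2 ∣ a
    -- This coset has six candidates, but the bound must be `7`: exchanging the axes swaps it with
    -- the coset of odd `a` and even `b`, which has seven.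
    · rw [overlapBound, if_neg (by omega)]
      refine (Set.encard_le_length (l := [halfShift 0 (-1) p, halfShift 0 1 p,
        halfShift 0 1 (-p), halfShift 1 0 (reflX p), halfShift (-1) 0 (reflY p),
        halfShift 1 0 (reflY p)]) fun q hq => ?_).trans (by norm_num)
      obtain ⟨m, n, ⟨rfl, e, h⟩ | ⟨rfl, e, h⟩ | ⟨rfl, e, h⟩ | ⟨rfl, e, h⟩⟩ := key q hq
      · obtain ⟨rfl, rfl⟩ | ⟨rfl, rfl⟩ : m = 0 ∧ n = -1 ∨ m = 0 ∧ n = 1 := by omega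
        all_goals simp only [List.mem_cons, true_or, or_true]
      · obtain ⟨rfl, rfl⟩ : m = 0 ∧ n = 1 := by omega
        simp only [List.mem_cons, true_or, or_true]
      · obtain ⟨rfl, rfl⟩ : m = 1 ∧ n = 0 := by omega
        simp only [List.mem_cons, true_or, or_true]
      · obtain ⟨rfl, rfl⟩ | ⟨rfl, rfl⟩ : m = -1 ∧ n = 0 ∨ m = 1 ∧ n = 0 := by omega
        all_goals simp only [List.mem_cons, true_or, or_true]
    by_cases hb : 2 ∣ b
    · rw [overlapBound, if_neg (by omega)]
      refine (Set.encard_le_length (l := [halfShift (-1) 0 p, halfShift 1 0 p,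
        halfShift 1 0 (-p), halfShift 0 (-1) (reflX p), halfShift 0 1 (reflX p),
        halfShift 0 (-1) (reflY p), halfShift 0 1 (reflY p)]) fun q hq => ?_).trans (by norm_num)
      obtain ⟨m, n, ⟨rfl, e, h⟩ | ⟨rfl, e, h⟩ | ⟨rfl, e, h⟩ | ⟨rfl, e, h⟩⟩ := key q hq
      · obtain ⟨rfl, rfl⟩ | ⟨rfl, rfl⟩ : m = -1 ∧ n = 0 ∨ m = 1 ∧ n = 0 := by omega
        all_goals simp only [List.mem_cons, true_or, or_true]
      · obtain ⟨rfl, rfl⟩ : m = 1 ∧ n = 0 := by omega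
        simp only [List.mem_cons, true_or, or_true]
      · obtain ⟨rfl, rfl⟩ | ⟨rfl, rfl⟩ : m = 0 ∧ n = -1 ∨ m = 0 ∧ n = 1 := by omega
        all_goals simp only [List.mem_cons, true_or, or_true]
      · obtain ⟨rfl, rfl⟩ | ⟨rfl, rfl⟩ : m = 0 ∧ n = -1 ∨ m = 0 ∧ n = 1 := by omega
        all_goals simp only [List.mem_cons, true_or, or_true]
    · rw [overlapBound, if_pos (by omega), if_neg (by simp [ha])]
      refine (Set.encard_le_length (l := [halfShift 1 1 (-p), halfShift 0 0 (reflX p),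
        halfShift 2 0 (reflX p), halfShift 0 0 (reflY p)]) fun q hq => ?_).trans (by norm_num)
      obtain ⟨m, n, ⟨rfl, e, h⟩ | ⟨rfl, e, h⟩ | ⟨rfl, e, h⟩ | ⟨rfl, e, h⟩⟩ := key q hq
      · omega
      · obtain ⟨rfl, rfl⟩ : m = 1 ∧ n = 1 := by omega
        simp only [List.mem_cons, true_or, or_true]
      · obtain ⟨rfl, rfl⟩ | ⟨rfl, rfl⟩ : m = 0 ∧ n = 0 ∨ m = 2 ∧ n = 0 := by omega
        all_goals simp only [List.mem_cons, true_or, or_true]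
      · obtain ⟨rfl, rfl⟩ : m = 0 ∧ n = 0 := by omega
        simp only [List.mem_cons, true_or, or_true]
  · have key : ∀ q ∈ overlapSet p (cosetRep true a b p), ∃ m n : ℤ,
        (q = halfShift m n p.swap ∧ (2 ∣ m - a ∧ 2 ∣ n - b) ∧
          (m = -1 ∧ n = 0 ∨ m = 0 ∧ n = -1 ∨ m = 0 ∧ n = 0 ∨ m = 0 ∧ n = 1 ∨ m = 1 ∧ n = -1 ∨
            m = 1 ∧ n = 0)) ∨
        (q = halfShift m n (-p.swap) ∧ (2 ∣ m - a ∧ 2 ∣ n - b) ∧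
          (m = 0 ∧ n = 0 ∨ m = 0 ∧ n = 1 ∨ m = 1 ∧ n = 0 ∨ m = 1 ∧ n = 1)) ∨
        (q = halfShift m n (reflX p.swap) ∧ (2 ∣ m - a - 1 ∧ 2 ∣ n - b - 1) ∧
          (m = 0 ∧ n = -1 ∨ m = 0 ∧ n = 0 ∨ m = 1 ∧ n = -1 ∨ m = 1 ∧ n = 0)) ∨
        (q = halfShift m n (reflY p.swap) ∧ (2 ∣ m - a - 1 ∧ 2 ∣ n - b - 1) ∧
          (m = 0 ∧ n = 0 ∨ m = 0 ∧ n = 1 ∨ m = 1 ∧ n = 0 ∨ m = 1 ∧ n = 1)) := by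
      rintro q ⟨hq, X, h1, h2⟩
      obtain ⟨m, n, ⟨rfl, e1, e2⟩ | ⟨rfl, e1, e2⟩ | ⟨rfl, e1, e2⟩ | ⟨rfl, e1, e2⟩⟩ :=
        exists_halfShift_of_mem_pggOrbit hq
      · exact ⟨m, n, .inl ⟨rfl, ⟨e1, e2⟩, overlap_swap t0 t1 t2 hx (cell h1)
          (cell ((normalizesPgg_swap.trans (shift m n)).inCell_symm h2))⟩⟩
      · exact ⟨m, n, .inr (.inl ⟨rfl, ⟨e1, e2⟩, overlap_negSwap t0 t1 t2 hx (cell h1)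
          (cell (((normalizesPgg_swap.trans normalizesPgg_neg).trans
            (shift m n)).inCell_symm h2))⟩)⟩
      · exact ⟨m, n, .inr (.inr (.inl ⟨rfl, ⟨e1, e2⟩, overlap_rotPos t0 t1 t2 hx (cell h1)
          (cell (((normalizesPgg_swap.trans normalizesPgg_reflX).trans
            (shift m n)).inCell_symm h2))⟩))⟩
      · exact ⟨m, n, .inr (.inr (.inr ⟨rfl, ⟨e1, e2⟩, overlap_rotNeg t0 t1 t2 hx (cell h1)
          (cell (((normalizesPgg_swap.trans normalizesPgg_reflY).trans
            (shift m n)).inCell_symm h2))⟩))⟩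
    by_cases ha : 2 ∣ a <;> by_cases hb : 2 ∣ b
    · rw [overlapBound, if_pos (by omega), if_neg (by simp)]
      refine (Set.encard_le_length (l := [halfShift 0 0 p.swap, halfShift 0 0 (-p.swap),
        halfShift 1 (-1) (reflX p.swap), halfShift 1 1 (reflY p.swap)])
        fun q hq => ?_).trans (by norm_num)
      obtain ⟨m, n, ⟨rfl, e, h⟩ | ⟨rfl, e, h⟩ | ⟨rfl, e, h⟩ | ⟨rfl, e, h⟩⟩ := key q hq
      · obtain ⟨rfl, rfl⟩ : m = 0 ∧ n = 0 := by omega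
        simp only [List.mem_cons, true_or, or_true]
      · obtain ⟨rfl, rfl⟩ : m = 0 ∧ n = 0 := by omega
        simp only [List.mem_cons, true_or, or_true]
      · obtain ⟨rfl, rfl⟩ : m = 1 ∧ n = -1 := by omega
        simp only [List.mem_cons, true_or, or_true]
      · obtain ⟨rfl, rfl⟩ : m = 1 ∧ n = 1 := by omega
        simp only [List.mem_cons, true_or, or_true]
    · rw [overlapBound, if_neg (by omega)]
      refine (Set.encard_le_length (l := [halfShift 0 (-1) p.swap, halfShift 0 1 p.swap,
        halfShift 0 1 (-p.swap), halfShift 1 0 (reflX p.swap), halfShift 1 0 (reflY p.swap)])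
        fun q hq => ?_).trans (by norm_num)
      obtain ⟨m, n, ⟨rfl, e, h⟩ | ⟨rfl, e, h⟩ | ⟨rfl, e, h⟩ | ⟨rfl, e, h⟩⟩ := key q hq
      · obtain ⟨rfl, rfl⟩ | ⟨rfl, rfl⟩ : m = 0 ∧ n = -1 ∨ m = 0 ∧ n = 1 := by omega
        all_goals simp only [List.mem_cons, true_or, or_true]
      · obtain ⟨rfl, rfl⟩ : m = 0 ∧ n = 1 := by omega
        simp only [List.mem_cons, true_or, or_true]
      · obtain ⟨rfl, rfl⟩ : m = 1 ∧ n = 0 := by omega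
        simp only [List.mem_cons, true_or, or_true]
      · obtain ⟨rfl, rfl⟩ : m = 1 ∧ n = 0 := by omega
        simp only [List.mem_cons, true_or, or_true]
    · rw [overlapBound, if_neg (by omega)]
      refine (Set.encard_le_length (l := [halfShift (-1) 0 p.swap, halfShift 1 0 p.swap,
        halfShift 1 0 (-p.swap), halfShift 0 (-1) (reflX p.swap), halfShift 0 1 (reflY p.swap)])
        fun q hq => ?_).trans (by norm_num)
      obtain ⟨m, n, ⟨rfl, e, h⟩ | ⟨rfl, e, h⟩ | ⟨rfl, e, h⟩ | ⟨rfl, e, h⟩⟩ := key q hq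
      · obtain ⟨rfl, rfl⟩ | ⟨rfl, rfl⟩ : m = -1 ∧ n = 0 ∨ m = 1 ∧ n = 0 := by omega
        all_goals simp only [List.mem_cons, true_or, or_true]
      · obtain ⟨rfl, rfl⟩ : m = 1 ∧ n = 0 := by omega
        simp only [List.mem_cons, true_or, or_true]
      · obtain ⟨rfl, rfl⟩ : m = 0 ∧ n = -1 := by omega
        simp only [List.mem_cons, true_or, or_true]
      · obtain ⟨rfl, rfl⟩ : m = 0 ∧ n = 1 := by omega
        simp only [List.mem_cons, true_or, or_true]
    · rw [overlapBound, if_pos (by omega), if_neg (by simp)]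
      refine (Set.encard_le_length (l := [halfShift 1 (-1) p.swap, halfShift 1 1 (-p.swap),
        halfShift 0 0 (reflX p.swap), halfShift 0 0 (reflY p.swap)])
        fun q hq => ?_).trans (by norm_num)
      obtain ⟨m, n, ⟨rfl, e, h⟩ | ⟨rfl, e, h⟩ | ⟨rfl, e, h⟩ | ⟨rfl, e, h⟩⟩ := key q hq
      · obtain ⟨rfl, rfl⟩ : m = 1 ∧ n = -1 := by omega
        simp only [List.mem_cons, true_or, or_true]
      · obtain ⟨rfl, rfl⟩ : m = 1 ∧ n = 1 := by omega
        simp only [List.mem_cons, true_or, or_true]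
      · obtain ⟨rfl, rfl⟩ : m = 0 ∧ n = 0 := by omega
        simp only [List.mem_cons, true_or, or_true]
      · obtain ⟨rfl, rfl⟩ : m = 0 ∧ n = 0 := by omega
        simp only [List.mem_cons, true_or, or_true]

/-- Closed diamonds leave four translations, four half-turns and six glides. -/
lemma encard_contactSet_of_triangle {p : ℝ × ℝ} (hp : InTriangle p) :
    (contactSet p).encard ≤ 14 := by
  by_cases hx : 0 < p.1
  swap
  · obtain rfl := hp.eq_zero hx
    exact encard_contactSet_zero
  refine (Set.encard_le_length (l := [halfShift 2 0 p, halfShift (-2) 0 p, halfShift 0 2 p,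
    halfShift 0 (-2) p, halfShift 0 0 (-p), halfShift 2 0 (-p), halfShift 0 2 (-p),
    halfShift 2 2 (-p), halfShift 1 1 (reflX p), halfShift 1 (-1) (reflX p),
    halfShift 1 1 (reflY p), halfShift (-1) 1 (reflY p), halfShift 1 (-1) (reflY p),
    halfShift (-1) (-1) (reflY p)]) ?_).trans (by norm_num)
  rintro q ⟨hq, hq0, X, h1, h2⟩
  obtain ⟨a1, a2, a3, a4⟩ := h1.diamond_le hp
  have shift (m n : ℤ) := normalizesPgg_halfShift m n
  have closed {X : ℝ × ℝ} (h : InClosedCell p X) := h.diamond_le hp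
  obtain ⟨t0, t1, t2⟩ := hp
  obtain ⟨m, n, ⟨rfl, e1, e2⟩ | ⟨rfl, e1, e2⟩ | ⟨rfl, e1, e2⟩ | ⟨rfl, e1, e2⟩⟩ :=
    exists_halfShift_of_mem_pggOrbit (a := 0) (b := 0) (p := p) (by rwa [halfShift_zero_zero])
  · obtain ⟨b1, b2, b3, b4⟩ := closed ((shift m n).inClosedCell_symm h2)
    simp only [halfShift_symm_apply] at b1 b2 b3 b4
    have h0 : ¬(m = 0 ∧ n = 0) := by
      rintro ⟨rfl, rfl⟩
      exact hq0 (halfShift_zero_zero p)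
    have c1 : m + n ≤ 2 := by rify; linarith
    have c2 : -2 ≤ m + n := by rify; linarith
    have c3 : m - n ≤ 2 := by rify; linarith
    have c4 : -2 ≤ m - n := by rify; linarith
    obtain ⟨rfl, rfl⟩ | ⟨rfl, rfl⟩ | ⟨rfl, rfl⟩ | ⟨rfl, rfl⟩ :
      m = 2 ∧ n = 0 ∨ m = -2 ∧ n = 0 ∨ m = 0 ∧ n = 2 ∨ m = 0 ∧ n = -2 := by omega
    all_goals simp only [List.mem_cons, true_or, or_true]
  · obtain ⟨b1, b2, b3, b4⟩ :=
      closed ((normalizesPgg_neg.trans (shift m n)).inClosedCell_symm h2)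
    simp only [Equiv.symm_trans_apply, halfShift_symm_apply, Equiv.neg_symm, Equiv.neg_apply,
      Prod.fst_neg, Prod.snd_neg] at b1 b2 b3 b4
    have c1 : m + n ≤ 4 := by rify; linarith
    -- The inequality is strict because `0 < p.1`.
    have c2 : -2 < m + n := by rify; linarith
    have c3 : m - n ≤ 3 := by rify; linarith
    have c4 : -2 ≤ m - n := by rify; linarith
    obtain ⟨rfl, rfl⟩ | ⟨rfl, rfl⟩ | ⟨rfl, rfl⟩ | ⟨rfl, rfl⟩ :
      m = 0 ∧ n = 0 ∨ m = 2 ∧ n = 0 ∨ m = 0 ∧ n = 2 ∨ m = 2 ∧ n = 2 := by omega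
    all_goals simp only [List.mem_cons, true_or, or_true]
  · obtain ⟨b1, b2, b3, b4⟩ :=
      closed ((normalizesPgg_reflX.trans (shift m n)).inClosedCell_symm h2)
    simp only [Equiv.symm_trans_apply, halfShift_symm_apply, reflX_symm_apply] at b1 b2 b3 b4
    have c1 : m + n ≤ 3 := by rify; linarith
    have c2 : -2 < m + n := by rify; linarith
    have c3 : m - n ≤ 3 := by rify; linarith
    have c4 : -2 < m - n := by rify; linarith
    obtain ⟨rfl, rfl⟩ | ⟨rfl, rfl⟩ : m = 1 ∧ n = 1 ∨ m = 1 ∧ n = -1 := by omega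
    all_goals simp only [List.mem_cons, true_or, or_true]
  · obtain ⟨b1, b2, b3, b4⟩ :=
      closed ((normalizesPgg_reflY.trans (shift m n)).inClosedCell_symm h2)
    simp only [Equiv.symm_trans_apply, halfShift_symm_apply, reflY_symm_apply] at b1 b2 b3 b4
    have c1 : m + n ≤ 3 := by rify; linarith
    have c2 : -2 ≤ m + n := by rify; linarith
    have c3 : m - n ≤ 2 := by rify; linarith
    have c4 : -3 ≤ m - n := by rify; linarith
    obtain ⟨rfl, rfl⟩ | ⟨rfl, rfl⟩ | ⟨rfl, rfl⟩ | ⟨rfl, rfl⟩ :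
      m = 1 ∧ n = 1 ∨ m = -1 ∧ n = 1 ∨ m = 1 ∧ n = -1 ∨ m = -1 ∧ n = -1 := by omega
    all_goals simp only [List.mem_cons, true_or, or_true]

lemma overlapSet_congr {p p' p'' : ℝ × ℝ} (h : p'' ∈ pggOrbit p') :
    overlapSet p p'' = overlapSet p p' := by
  simp only [overlapSet, pggOrbit_eq h]

/-! ### From the triangle to the whole plane. -/

/-- The bounds for the numbers of touching and overlapping cells hold at `p`. -/
def CellBounds (p : ℝ × ℝ) : Prop :=
  (contactSet p).encard ≤ 14 ∧
    ∀ s a b, (overlapSet p (cosetRep s a b p)).encard ≤ overlapBound s a b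

/-- Conjugation by `ν` permutes the cosets; `h'` asks that it preserve exactly the parities on which
`overlapBound` depends. -/
lemma NormalizesPgg.cellBounds {ν : ℝ × ℝ ≃ ℝ × ℝ} (hν : NormalizesPgg ν) {p : ℝ × ℝ}
    (h : CellBounds (ν p))
    (h' : ∀ s a b, ∃ a' b', cosetRep s a' b' (ν p) ∈ pggOrbit (ν (cosetRep s a b p)) ∧
      (2 ∣ a' + b' ↔ 2 ∣ a + b) ∧ (2 ∣ a + b → s = false → (2 ∣ a' ↔ 2 ∣ a))) :
    CellBounds p := by
  refine ⟨by rw [← hν.encard_contactSet]; exact h.1, fun s a b => ?_⟩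
  obtain ⟨a', b', hab, hp, ha⟩ := h' s a b
  rw [← hν.encard_overlapSet, ← overlapSet_congr hab]
  have e : overlapBound s a' b' = overlapBound s a b := by
    unfold overlapBound
    by_cases hd : 2 ∣ a + b
    · rw [if_pos hd, if_pos (hp.2 hd)]
      cases s
      · simp [ha hd rfl]
      · simp
    · rw [if_neg hd, if_neg (mt hp.1 hd)]
  exact e ▸ h.2 s a' b'

lemma cellBounds_halfShift (p : ℝ × ℝ) : CellBounds (halfShift 1 0 p) ↔ CellBounds p := by
  have key (k : ℤ) (p : ℝ × ℝ) (h : CellBounds (halfShift k 0 p)) : CellBounds p := by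
    refine (normalizesPgg_halfShift k 0).cellBounds h fun s a b => ?_
    cases s
    · exact ⟨a, b, by
        convert self_mem_pggOrbit _ using 1
        ext <;> simp [cosetRep]
        ring, by simp, by simp⟩
    -- The shift does not commute with exchanging the axes; the correction `(k, -k)` keeps the
    -- parity of the sum.
    · exact ⟨a + k, b - k, by
        convert self_mem_pggOrbit _ using 1
        ext <;> (simp [cosetRep]; ring), by rw [show a + k + (b - k) = a + b by ring], by simp⟩
  refine ⟨key 1 p, fun h => key (-1) _ ?_⟩
  convert h using 1
  ext <;> simp
  ring

lemma cellBounds_of_reflX {p : ℝ × ℝ} (h : CellBounds (reflX p)) : CellBounds p := by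
  refine normalizesPgg_reflX.cellBounds h fun s a b => ?_
  cases s
  · exact ⟨-a, b, by
      convert self_mem_pggOrbit _ using 1
      ext <;> simp [cosetRep]
      ring, by omega, by omega⟩
  -- The two points agree only up to the half-turn about the origin.
  · exact ⟨a, -b, ⟨0, 0, .inr (.inl (by ext <;> simp [cosetRep] <;> ring))⟩, by omega, by simp⟩

lemma cellBounds_of_swap {p : ℝ × ℝ} (h : CellBounds p.swap) : CellBounds p := by
  refine normalizesPgg_swap.cellBounds h fun s a b => ⟨b, a, ?_, by omega, by omega⟩
  convert self_mem_pggOrbit _ using 1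
  cases s <;> ext <;> simp [cosetRep]

lemma cellBounds (p : ℝ × ℝ) : CellBounds p := by
  have tri (x y : ℝ) (h0 : 0 ≤ y) (h1 : y ≤ x) (h2 : x ≤ 1 / 4) : CellBounds (x, y) :=
    have h : InTriangle (x, y) := ⟨h0, sub_nonneg.2 h1, sub_nonneg.2 h2⟩
    ⟨encard_contactSet_of_triangle h, encard_overlapSet_of_triangle h⟩
  have square (x y : ℝ) (hx : 0 ≤ x) (hx' : x ≤ 1 / 4) (hy : 0 ≤ y) (hy' : y ≤ 1 / 4) :
      CellBounds (x, y) := by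
    rcases le_total y x with h | h
    · exact tri x y hy h hx'
    · exact cellBounds_of_swap (tri y x hx h hy')
  have strip (x y : ℝ) (hy : 0 ≤ y) (hy' : y ≤ 1 / 4) : CellBounds (x, y) := by
    have per : Function.Periodic (fun x => CellBounds (x, y)) (1 / 2) := fun x =>
      propext (by simpa using cellBounds_halfShift (x, y))
    obtain ⟨t, ht, h⟩ := per.exists_mem_Ico (by norm_num) x (-1 / 4)
    rw [h]
    rcases le_total 0 t with h0 | h0
    · exact square t y h0 (by linarith [ht.2]) hy hy'
    · refine cellBounds_of_reflX (square (-t) y (by linarith) (by linarith [ht.1]) hy hy')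
  obtain ⟨x, y⟩ := p
  have per : Function.Periodic (fun y => CellBounds (x, y)) (1 / 2) := fun y => by
    refine propext ⟨fun h => ?_, fun h => ?_⟩
    · refine cellBounds_of_swap ((cellBounds_halfShift _).1 (cellBounds_of_swap ?_))
      simpa using h
    · refine cellBounds_of_swap ?_
      have := (cellBounds_halfShift (y, x)).2 (cellBounds_of_swap h)
      simpa using this
  obtain ⟨t, ht, h⟩ := per.exists_mem_Ico (by norm_num) y (-1 / 4)
  rw [h]
  rcases le_total 0 t with h0 | h0
  · exact strip x t h0 (by linarith [ht.2])
  · refine cellBounds_of_swap (cellBounds_of_reflX (cellBounds_of_swap ?_))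
    exact strip x (-t) (by linarith) (by linarith [ht.1])

/-! ### Counting neighbours layer by layer -/

/-- A rescaled squared Euclidean distance, with vertical direction the last coordinate. -/
def scaledSqd (a c : ℝ) (X Q : (ℝ × ℝ) × ℝ) : ℝ := a * sqd X.1 Q.1 + c * (X.2 - Q.2) ^ 2

/-- The points `Q` of `T` such that `P` and `Q` are the two points of `T` nearest to some `X`. -/
def neighbours (a c : ℝ) (T : Set ((ℝ × ℝ) × ℝ)) (P : (ℝ × ℝ) × ℝ) : Set ((ℝ × ℝ) × ℝ) :=
  {Q | Q ∈ T ∧ Q ≠ P ∧ ∃ X, scaledSqd a c X P = scaledSqd a c X Q ∧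
    ∀ R ∈ T, R ≠ P → R ≠ Q → scaledSqd a c X P < scaledSqd a c X R}

/-- A family of horizontal layers: a coset of `pgg` in its normalizer and a height modulo `1`. -/
structure Layer where
  isSwap : Bool
  fst : ℤ
  snd : ℤ
  height : ℝ

/-- The point `Q` belongs to the family of layers `L` relative to `P`. -/
def Layer.Mem (L : Layer) (P Q : (ℝ × ℝ) × ℝ) : Prop :=
  Q.1 ∈ pggOrbit (cosetRep L.isSwap L.fst L.snd P.1) ∧ ∃ k : ℤ, Q.2 = P.2 + L.height + k

lemma Set.encard_exists_mem_list_le {α β : Type*} (S : α → Set β) (l : List α) :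
    {q | ∃ x ∈ l, q ∈ S x}.encard ≤ (l.map fun x => (S x).encard).sum := by
  induction l with
  | nil => simp
  | cons x l ih =>
    have : {q | ∃ y ∈ x :: l, q ∈ S y} = S x ∪ {q | ∃ y ∈ l, q ∈ S y} := by
      ext q; simp
    rw [this, List.map_cons, List.sum_cons]
    exact (Set.encard_union_le _ _).trans (add_le_add le_rfl ih)

theorem encard_neighbours_le {a c : ℝ} (ha : 0 < a) (hc : 0 < c) {T : Set ((ℝ × ℝ) × ℝ)}
    {P : (ℝ × ℝ) × ℝ} (hP : P ∈ T)
    (hT : ∀ Q ∈ T, ∀ r ∈ pggOrbit Q.1, ∀ k : ℤ, (r, Q.2 + k) ∈ T) (l : List Layer)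
    (hl : ∀ Q ∈ T, (Q.1 ∈ pggOrbit P.1 ∧ ∃ k : ℤ, Q.2 = P.2 + k) ∨ ∃ L ∈ l, L.Mem P Q) :
    (neighbours a c T P).encard ≤
      2 + 14 + (l.map fun L => 2 * overlapBound L.isSwap L.fst L.snd).sum := by
  obtain ⟨hcontact, hoverlap⟩ := cellBounds P.1
  let at' (h : ℝ) (q : ℝ × ℝ) : (ℝ × ℝ) × ℝ := (q, h)
  let S (L : Layer) : Set ((ℝ × ℝ) × ℝ) :=
    at' (P.2 + Int.fract L.height) '' overlapSet P.1 (cosetRep L.isSwap L.fst L.snd P.1) ∪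
    at' (P.2 + Int.fract L.height - 1) '' overlapSet P.1 (cosetRep L.isSwap L.fst L.snd P.1)
  have hS (L : Layer) : (S L).encard ≤ 2 * overlapBound L.isSwap L.fst L.snd := by
    rw [two_mul]
    exact (Set.encard_union_le _ _).trans (add_le_add
      ((Set.encard_image_le _ _).trans (hoverlap _ _ _))
      ((Set.encard_image_le _ _).trans (hoverlap _ _ _)))
  have hsub : neighbours a c T P ⊆
      ({(P.1, P.2 + 1), (P.1, P.2 - 1)} ∪ at' P.2 '' contactSet P.1) ∪
        {Q | ∃ L ∈ l, Q ∈ S L} := by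
    rintro Q ⟨hQ, hQP, X, heq, hlt⟩
    have hle (R) (hR : R ∈ T) : scaledSqd a c X P ≤ scaledSqd a c X R := by
      by_cases h : R = P
      · rw [h]
      by_cases h' : R = Q
      · rw [h', heq]
      exact (hlt R hR h h').le
    by_cases hv : Q = (P.1, P.2 + 1) ∨ Q = (P.1, P.2 - 1)
    · exact .inl (.inl hv)
    obtain ⟨hv1, hv2⟩ := not_or.1 hv
    -- A vertical translate of `P` has the same horizontal distance from `X`, so only heights are
    -- compared.
    have vP (k : ℤ) (hk : k ≠ 0) (h : Q ≠ (P.1, P.2 + k)) :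
        (X.2 - P.2) ^ 2 < (X.2 - P.2 - k) ^ 2 := by
      have := hlt _ (hT P hP _ (self_mem_pggOrbit _) k)
        (fun e => hk (by simpa using congrArg Prod.snd e)) h.symm
      simp only [scaledSqd] at this
      have := (mul_lt_mul_iff_right₀ hc).1 (lt_of_add_lt_add_left this)
      rwa [sub_sub]
    have vQ (k : ℤ) (hk : k ≠ 0) (h : Q ≠ (P.1, P.2 - k)) :
        (X.2 - Q.2) ^ 2 < (X.2 - Q.2 - k) ^ 2 := by
      have := hlt _ (hT Q hQ _ (self_mem_pggOrbit _) k)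
        (fun e => h (by rw [← e]; simp)) (fun e => hk (by simpa using congrArg Prod.snd e))
      rw [heq] at this
      simp only [scaledSqd] at this
      have := (mul_lt_mul_iff_right₀ hc).1 (lt_of_add_lt_add_left this)
      rwa [sub_sub]
    have p1 := vP 1 one_ne_zero (by simpa using hv1)
    have p2 := vP (-1) (by simp) (by simpa [sub_eq_add_neg] using hv2)
    have q1 := vQ 1 one_ne_zero (by simpa using hv2)
    have q2 := vQ (-1) (by simp) (by simpa using hv1)
    push_cast at p1 p2 q1 q2
    -- The height of `X` is within `1/2` of the heights of both `P` and `Q`.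
    have hlow : -1 < Q.2 - P.2 := by nlinarith
    have hupp : Q.2 - P.2 < 1 := by nlinarith
    have planar {R R' : (ℝ × ℝ) × ℝ} (h2 : R.2 = R'.2) :
        (scaledSqd a c X R ≤ scaledSqd a c X R' ↔ sqd X.1 R.1 ≤ sqd X.1 R'.1) ∧
        (scaledSqd a c X R < scaledSqd a c X R' ↔ sqd X.1 R.1 < sqd X.1 R'.1) := by
      simp [scaledSqd, h2, ha]
    have layer {R : (ℝ × ℝ) × ℝ} (hR : R ∈ T) {r : ℝ × ℝ} (hr : r ∈ pggOrbit R.1) :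
        (r, R.2) ∈ T := by
      simpa using hT R hR r hr 0
    -- In this case `Q` competes with `P` inside one planar orbit, so only closed cells are
    -- available.
    by_cases hsame : Q.1 ∈ pggOrbit P.1 ∧ ∃ k : ℤ, Q.2 = P.2 + k
    · obtain ⟨horb, k, hk⟩ := hsame
      have k1 : -1 < k := by rify; linarith
      have k2 : k < 1 := by rify; linarith
      obtain rfl : k = 0 := by omega
      have hk : Q.2 = P.2 := by simpa using hk
      refine .inl (.inr ⟨Q.1, ⟨horb, fun e => hQP (Prod.ext e hk), X.1, fun r hr => ?_,
        fun r hr => ?_⟩, Prod.ext rfl hk.symm⟩)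
      · exact (planar (R := P) (R' := (r, P.2)) rfl).1.1 (hle _ (layer hP hr))
      · exact (planar (R := Q) (R' := (r, Q.2)) rfl).1.1 (heq ▸ hle _ (layer hQ hr))
    obtain ⟨L, hL, horb, k, hk⟩ := (hl Q hQ).resolve_left hsame
    -- Neither layer contains the other point, so all planar comparisons are strict.
    have hmem : Q.1 ∈ overlapSet P.1 (cosetRep L.isSwap L.fst L.snd P.1) := by
      refine ⟨horb, X.1, fun r hr hne => ?_, fun r hr hne => ?_⟩
      · refine (planar (R := P) (R' := (r, P.2)) rfl).2.1 (hlt _ (layer hP hr)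
          (fun e => hne (by rw [← e])) fun e => hsame ⟨?_, 0, ?_⟩) <;> simp [← e, hr]
      · refine (planar (R := Q) (R' := (r, Q.2)) rfl).2.1 (heq ▸ hlt _ (layer hQ hr)
          (fun e => hsame ⟨pggOrbit_symm ?_, 0, ?_⟩) (fun e => hne (by rw [← e]))) <;>
          simp [← e, hr]
    have hfl := Int.floor_add_fract L.height
    have f0 := Int.fract_nonneg L.height
    have f1 := Int.fract_lt_one L.height
    have k1 : -2 < ⌊L.height⌋ + k := by rify; linarith
    have k2 : ⌊L.height⌋ + k < 1 := by rify; linarith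
    refine .inr ⟨L, hL, ?_⟩
    -- Height differences in `(-1, 1)` that are congruent to `L.height` modulo `1` equal its
    -- fractional part or that minus `1`.
    obtain h | h : ⌊L.height⌋ + k = 0 ∨ ⌊L.height⌋ + k = -1 := by omega
    · refine .inl ⟨Q.1, hmem, Prod.ext rfl ?_⟩
      rify at h
      simp only [at']
      linarith
    · refine .inr ⟨Q.1, hmem, Prod.ext rfl ?_⟩
      rify at h
      simp only [at']
      linarith
  refine (Set.encard_le_encard hsub).trans ((Set.encard_union_le _ _).trans (add_le_add
    ((Set.encard_union_le _ _).trans (add_le_add ?_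
      ((Set.encard_image_le _ _).trans hcontact))) ?_))
  · exact (Set.encard_insert_le _ _).trans (by rw [Set.encard_singleton]; norm_num)
  · exact (Set.encard_exists_mem_list_le S l).trans (List.sum_le_sum fun L _ => hS L)

/-! ### Facets of Voronoi regions -/

section
variable {E : Type*} [NormedAddCommGroup E] [NormedSpace ℝ E]

/-- The segment from `X` to `X₀` extends slightly beyond `X₀` inside `F`; if `g X < g X₀`, then `g`
would exceed its maximum there. -/
lemma eq_of_le_of_mem_intrinsicInterior {F : Set E} {X₀ : E} (h₀ : X₀ ∈ intrinsicInterior ℝ F)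
    (g : E →ₗ[ℝ] ℝ) (hg : ∀ X ∈ F, g X ≤ g X₀) {X : E} (hX : X ∈ F) : g X = g X₀ := by
  obtain ⟨y, hy, rfl⟩ := mem_intrinsicInterior.1 h₀
  let γ : ℝ → affineSpan ℝ F := fun t => ⟨AffineMap.lineMap X (y : E) t,
    AffineMap.lineMap_mem t (subset_affineSpan ℝ F hX) y.2⟩
  have hγ : Continuous γ := Continuous.subtype_mk AffineMap.lineMap_continuous _
  have h1 : γ 1 = y := Subtype.ext (by simp [γ])
  have hev : ∀ᶠ t in nhds (1 : ℝ), γ t ∈ interior ((↑) ⁻¹' F : Set (affineSpan ℝ F)) :=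
    hγ.continuousAt.eventually_mem (isOpen_interior.mem_nhds (h1 ▸ hy))
  obtain ⟨t, ht, ht1⟩ := ((hev.filter_mono nhdsWithin_le_nhds).and
    (self_mem_nhdsWithin : Set.Ioi (1 : ℝ) ∈ nhdsWithin 1 (Set.Ioi 1))).exists
  have hmem : AffineMap.lineMap X (y : E) t ∈ F :=
    interior_subset (s := ((↑) ⁻¹' F : Set (affineSpan ℝ F))) ht
  have h2 := hg _ hmem
  have h3 := hg X hX
  rw [AffineMap.lineMap_apply_module', map_add, map_smul, map_sub, smul_eq_mul] at h2
  have ht1 : 1 < t := ht1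
  nlinarith

end

section
open scoped RealInnerProductSpace
variable {X P Q : Space}

lemma dist_sq_sub_dist_sq (X P Q : Space) :
    dist X Q ^ 2 - dist X P ^ 2 = ‖Q - P‖ ^ 2 - 2 * ⟪Q - P, X - P⟫ := by
  rw [dist_eq_norm, dist_eq_norm, show X - Q = (X - P) - (Q - P) by abel, norm_sub_sq_real,
    real_inner_comm]
  ring

lemma dist_le_dist_iff_inner : dist X P ≤ dist X Q ↔ 2 * ⟪Q - P, X - P⟫ ≤ ‖Q - P‖ ^ 2 := by
  rw [← sq_le_sq₀ dist_nonneg dist_nonneg, ← sub_nonneg, dist_sq_sub_dist_sq, sub_nonneg]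

lemma dist_eq_dist_iff_inner : dist X P = dist X Q ↔ 2 * ⟪Q - P, X - P⟫ = ‖Q - P‖ ^ 2 := by
  rw [← sq_eq_sq₀ dist_nonneg dist_nonneg, eq_comm, ← sub_eq_zero, dist_sq_sub_dist_sq,
    sub_eq_zero, eq_comm]

/-- The points `Q` of `S` such that `P` and `Q` are the two points of `S` nearest to some `X`. -/
def strictNeighbours (S : Set Space) (P : Space) : Set Space :=
  {Q | Q ∈ S ∧ Q ≠ P ∧ ∃ X, dist X P = dist X Q ∧ ∀ R ∈ S, R ≠ P → R ≠ Q → dist X P < dist X R}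

lemma convex_voronoiRegion (S : Set Space) (P : Space) : Convex ℝ (voronoiRegion S P) := by
  have : voronoiRegion S P = ⋂ Q ∈ S, {X | ⟪Q - P, X⟫ ≤ ‖Q - P‖ ^ 2 / 2 + ⟪Q - P, P⟫} := by
    ext X
    simp only [voronoiRegion, Set.mem_ofPred_eq, Set.mem_iInter, dist_le_dist_iff_inner,
      inner_sub_right]
    refine forall₂_congr fun Q _ => ?_
    constructor <;> intro h <;> linarith
  rw [this]
  exact convex_iInter₂ fun Q _ => convex_halfSpace_le (innerₗ Space (Q - P)).isLinear _

/-- Within distance `1/2` of `X` only points of `S` at distance at most `dist X P + 1` can compete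
with `P`, and there are finitely many. -/
lemma voronoiRegion_mem_nhds {S : Set Space} (hS : ∀ X r, {Q ∈ S | dist X Q ≤ r}.Finite)
    (h : ∀ R ∈ S, R ≠ P → dist X P < dist X R) : voronoiRegion S P ∈ nhds X := by
  have h1 : ∀ᶠ Y in nhds X, ∀ R ∈ {Q ∈ S | dist X Q ≤ dist X P + 1}, dist Y P ≤ dist Y R := by
    rw [Filter.eventually_all_finite (hS X (dist X P + 1))]
    rintro R ⟨hR, -⟩
    by_cases hRP : R = P
    · simp [hRP]
    · have := (continuous_id.dist continuous_const).continuousAt.eventually_lt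
        ((continuous_id (X := Space)).dist continuous_const).continuousAt (h R hR hRP)
      filter_upwards [this] with Y hY using hY.le
  filter_upwards [h1, Metric.ball_mem_nhds X (by norm_num : (0 : ℝ) < 1 / 2)] with Y hY hYX R hR
  by_cases hd : dist X R ≤ dist X P + 1
  · exact hY R ⟨hR, hd⟩
  · have a := dist_triangle Y X P
    have b := dist_triangle X Y R
    rw [Metric.mem_ball] at hYX
    rw [dist_comm X Y] at b
    linarith

lemma vectorSpan_eq_ker {F : Set Space} (hF : Module.finrank ℝ (vectorSpan ℝ F) = 2)
    {g : Space →ₗ[ℝ] ℝ} (hg : g ≠ 0) {X₀ : Space} (hc : ∀ X ∈ F, g X = g X₀) :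
    vectorSpan ℝ F = LinearMap.ker g := by
  have h := Module.Dual.finrank_ker_add_one_of_ne_zero (f := g) hg
  rw [finrank_euclideanSpace_fin] at h
  refine Submodule.eq_of_le_of_finrank_eq ?_ (by omega)
  rw [vectorSpan, Submodule.span_le]
  rintro _ ⟨X, hX, Y, hY, rfl⟩
  simp [hc X hX, hc Y hY]

lemma exists_eq_smul_of_ker_inner_eq {u w : Space} (hu : u ≠ 0)
    (h : LinearMap.ker (innerₗ Space u) = LinearMap.ker (innerₗ Space w)) :
    ∃ t : ℝ, w = t • u := by
  have hn : ‖u‖ ^ 2 ≠ 0 := by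
    have := norm_pos_iff.2 hu
    positivity
  have hmem : w - (⟪u, w⟫ / ‖u‖ ^ 2) • u ∈ LinearMap.ker (innerₗ Space u) := by
    rw [LinearMap.mem_ker, innerₗ_apply_apply, inner_sub_right, inner_smul_right,
      real_inner_self_eq_norm_sq, div_mul_cancel₀ _ hn, sub_self]
  refine ⟨⟪u, w⟫ / ‖u‖ ^ 2, sub_eq_zero.1 ((inner_self_eq_zero (𝕜 := ℝ)).1 ?_)⟩
  have hmem' := h ▸ hmem
  rw [LinearMap.mem_ker, innerₗ_apply_apply] at hmem hmem'
  rw [inner_sub_left, hmem', inner_smul_left, hmem]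
  simp

/-- A relative interior point of the facet lies on exactly one bisector, and that bisector recovers
the facet. -/
theorem facets_subset_image {S : Set Space} {P : Space}
    (hS : ∀ X r, {Q ∈ S | dist X Q ≤ r}.Finite) :
    {F | IsFacet (voronoiRegion S P) F} ⊆
      (fun Q => {X ∈ voronoiRegion S P | dist X P = dist X Q}) '' strictNeighbours S P := by
  rintro F ⟨hne, hexp, hdim⟩
  set K := voronoiRegion S P
  have hconv : Convex ℝ K := convex_voronoiRegion S P
  have hFK : F ⊆ K := hexp.subset
  have hK3 : Module.finrank ℝ (vectorSpan ℝ K) = 3 := by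
    have hint : (interior K).Nonempty := ⟨P, mem_interior_iff_mem_nhds.2
      (voronoiRegion_mem_nhds hS fun R _ hRP => by simpa using dist_pos.2 hRP.symm)⟩
    have h1 : affineSpan ℝ K = ⊤ := hconv.interior_nonempty_iff_affineSpan_eq_top.1 hint
    rw [← direction_affineSpan, h1, AffineSubspace.direction_top, finrank_top,
      finrank_euclideanSpace_fin]
  have hF2 : Module.finrank ℝ (vectorSpan ℝ F) = 2 := by omega
  obtain ⟨l, hl⟩ := hexp hne
  have hl0 : l ≠ 0 := by
    rintro rfl
    have : F = K := by rw [hl]; simp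
    rw [this] at hdim
    omega
  obtain ⟨X₀, hX₀⟩ := hne.intrinsicInterior (hexp.convex hconv)
  have hX₀F : X₀ ∈ F := intrinsicInterior_subset hX₀
  have hconst (R : Space) (hR : R ∈ S) (he : dist X₀ P = dist X₀ R) (X) (hX : X ∈ F) :
      ⟪R - P, X⟫ = ⟪R - P, X₀⟫ := by
    refine eq_of_le_of_mem_intrinsicInterior hX₀ (innerₗ Space (R - P)) (fun Y hY => ?_) hX
    have h1 := dist_le_dist_iff_inner.1 (hFK hY R hR)
    have h2 := dist_eq_dist_iff_inner.1 he
    simp only [inner_sub_right] at h1 h2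
    simp only [innerₗ_apply_apply]
    linarith
  have hker (R : Space) (hR : R ∈ S) (hRP : R ≠ P) (he : dist X₀ P = dist X₀ R) :
      vectorSpan ℝ F = LinearMap.ker (innerₗ Space (R - P)) :=
    vectorSpan_eq_ker hF2 (fun h => hRP (sub_eq_zero.1 (inner_self_eq_zero.1
      (LinearMap.congr_fun h (R - P))))) (X₀ := X₀) (hconst R hR he)
  obtain ⟨Q, hQ, hQP, heq⟩ : ∃ Q ∈ S, Q ≠ P ∧ dist X₀ P = dist X₀ Q := by
    by_contra! hcon
    -- Off every bisector `X₀` would be interior to `K`, where a nonzero linear functional has no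
    -- local maximum.
    have hnhds : K ∈ nhds X₀ := voronoiRegion_mem_nhds hS fun R hR hRP =>
      lt_of_le_of_ne (hFK hX₀F R hR) (hcon R hR hRP)
    refine hl0 (ContinuousLinearMap.ext fun v => ?_)
    have hmax : IsLocalMax l X₀ := by
      filter_upwards [hnhds] with Y hY
      rw [hl] at hX₀F
      exact hX₀F.2 Y hY
    have := hmax.hasFDerivAt_eq_zero l.hasFDerivAt
    rw [this]
  refine ⟨Q, ⟨hQ, hQP, X₀, heq, fun R hR hRP hRQ => ?_⟩, ?_⟩
  · refine lt_of_le_of_ne (hFK hX₀F R hR) fun he => hRQ ?_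
    have hkk : LinearMap.ker (innerₗ Space (Q - P)) = LinearMap.ker (innerₗ Space (R - P)) :=
      (hker Q hQ hQP heq).symm.trans (hker R hR hRP he)
    have e1 := dist_eq_dist_iff_inner.1 heq
    have e2 := dist_eq_dist_iff_inner.1 he
    -- Both bisectors contain `F`, so they are parallel; passing through the same `X₀` forces `t = t
    -- ^ 2`, and `t ≠ 0`.
    obtain ⟨t, ht⟩ := exists_eq_smul_of_ker_inner_eq (sub_ne_zero.2 hQP) hkk
    rw [ht, inner_smul_left, norm_smul, mul_pow, Real.norm_eq_abs, sq_abs] at e2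
    have hn : 0 < ‖Q - P‖ ^ 2 := by
      have := norm_pos_iff.2 (sub_ne_zero.2 hQP)
      positivity
    have ht0 : t ≠ 0 := by
      rintro rfl
      exact hRP (sub_eq_zero.1 (by simpa using ht))
    have h3 : t * ‖Q - P‖ ^ 2 * (t - 1) = 0 := by
      simp only [conj_trivial] at e2
      linear_combination t * e1 - e2
    have ht1 : t = 1 := by
      have := (mul_eq_zero.1 h3).resolve_left (mul_ne_zero ht0 hn.ne')
      linarith
    rw [ht1, one_smul] at ht
    exact sub_left_injective ht
  -- The exposing hyperplane and the bisector of `P` and `Q` have the same direction and share `X₀`,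
  -- hence coincide.
  · have hlc : ∀ X ∈ F, (l : Space →ₗ[ℝ] ℝ) X = (l : Space →ₗ[ℝ] ℝ) X₀ := by
      intro X hX
      rw [hl] at hX hX₀F
      exact le_antisymm (hX₀F.2 X hX.1) (hX.2 X₀ hX₀F.1)
    have hkl : vectorSpan ℝ F = LinearMap.ker (l : Space →ₗ[ℝ] ℝ) :=
      vectorSpan_eq_ker hF2 (fun h => hl0 (ContinuousLinearMap.coe_injective h)) hlc
    ext X
    constructor
    · rintro ⟨hXK, hXe⟩
      have hX : X - X₀ ∈ LinearMap.ker (innerₗ Space (Q - P)) := by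
        have e1 := dist_eq_dist_iff_inner.1 heq
        have e2 := dist_eq_dist_iff_inner.1 hXe
        simp only [LinearMap.mem_ker, innerₗ_apply_apply, inner_sub_right] at *
        linarith
      rw [← hker Q hQ hQP heq, hkl, LinearMap.mem_ker, map_sub, sub_eq_zero] at hX
      rw [hl] at hX₀F ⊢
      exact ⟨hXK, fun Y hY => (hX₀F.2 Y hY).trans_eq hX.symm⟩
    · intro hX
      refine ⟨hFK hX, ?_⟩
      have e1 := dist_eq_dist_iff_inner.1 heq
      have e2 := hconst Q hQ heq X hX
      rw [dist_eq_dist_iff_inner]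
      simp only [inner_sub_right] at *
      linarith

theorem numFacets_voronoiRegion_le {S : Set Space} {P : Space}
    (hS : ∀ X r, {Q ∈ S | dist X Q ≤ r}.Finite) :
    numFacets (voronoiRegion S P) ≤ (strictNeighbours S P).encard :=
  (Set.encard_le_encard (facets_subset_image hS)).trans (Set.encard_image_le _ _)

end

/-! ### Fractional coordinates -/

section
open scoped RealInnerProductSpace

lemma AffineEquiv.dist_symm_eq (φ : Space ≃ᵃ[ℝ] (Fin 3 → ℝ)) (X Y : Space) :
    dist X Y = ‖φ.symm.linear (φ X - φ Y)‖ := by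
  have := φ.symm.toAffineMap.linearMap_vsub (φ X) (φ Y)
  simp only [AffineEquiv.linear_toAffineMap, vsub_eq_sub, AffineEquiv.coe_toAffineMap,
    AffineEquiv.symm_apply_apply] at this
  rw [dist_eq_norm, ← this]
  rfl

/-- In coordinates for which some isometry is a fourfold rotation or rotoinversion with vertical
axis, the metric is diagonal with equal horizontal coefficients. -/
theorem exists_dist_sq_eq (φ : Space ≃ᵃ[ℝ] (Fin 3 → ℝ)) {ε : ℝ} (hε : ε * ε = 1) (t : Fin 3 → ℝ)
    (g : Space ≃ᵃⁱ[ℝ] Space) (hg : ∀ X, φ (g X) = ![-φ X 1, φ X 0, ε * φ X 2] + t) :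
    ∃ a c : ℝ, 0 < a ∧ 0 < c ∧ ∀ X Y, dist X Y ^ 2 =
      a * ((φ X 0 - φ Y 0) ^ 2 + (φ X 1 - φ Y 1) ^ 2) + c * (φ X 2 - φ Y 2) ^ 2 := by
  set A := φ.symm.linear
  have hA (u : Fin 3 → ℝ) : A u = u 0 • A ![1, 0, 0] + u 1 • A ![0, 1, 0] + u 2 • A ![0, 0, 1] := by
    rw [← map_smul, ← map_smul, ← map_smul, ← map_add, ← map_add]
    congr 1
    ext i
    fin_cases i <;> simp
  set e := A ![1, 0, 0] with he
  set e' := A ![0, 1, 0] with he'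
  set e'' := A ![0, 0, 1] with he''
  have hN (x y z : ℝ) : ‖A ![x, y, z]‖ ^ 2 = x ^ 2 * ‖e‖ ^ 2 + y ^ 2 * ‖e'‖ ^ 2 + z ^ 2 * ‖e''‖ ^ 2 +
      2 * x * y * ⟪e, e'⟫ + 2 * x * z * ⟪e, e''⟫ + 2 * y * z * ⟪e', e''⟫ := by
    rw [hA]
    simp only [norm_add_sq_real, inner_add_left, inner_smul_left, inner_smul_right, norm_smul,
      mul_pow, Real.norm_eq_abs, sq_abs, conj_trivial, Matrix.cons_val_zero, Matrix.cons_val_one,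
      Matrix.cons_val]
    ring
  have hinv (x y z : ℝ) : ‖A ![-y, x, ε * z]‖ ^ 2 = ‖A ![x, y, z]‖ ^ 2 := by
    have h := g.dist_map (φ.symm ![x, y, z]) (φ.symm 0)
    rw [φ.dist_symm_eq, φ.dist_symm_eq, hg, hg] at h
    simp only [AffineEquiv.apply_symm_apply, add_sub_add_right_eq_sub, sub_zero] at h
    rw [← h]
    congr 3
    ext i
    fin_cases i <;> simp
  -- The first two vectors give `‖e'‖ = ‖e‖` and `e ⊥ e'`; the last two give relations between the
  -- products with `e''` that force both to vanish because `ε * ε = 1`.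
  have k1 := hinv 1 0 0
  have k2 := hinv 1 1 0
  have k3 := hinv 1 0 1
  have k4 := hinv 0 1 1
  simp only [hN] at k1 k2 k3 k4
  have b1 : ‖e'‖ ^ 2 = ‖e‖ ^ 2 := by linear_combination k1
  have b2 : ⟪e, e'⟫ = 0 := by linear_combination -k2 / 4
  have h3 : ⟪e, e''⟫ = ε * ⟪e', e''⟫ := by
    linear_combination -k3 / 2 + b1 / 2 + hε * ‖e''‖ ^ 2 / 2
  have h4 : ⟪e', e''⟫ = -ε * ⟪e, e''⟫ := by
    linear_combination -k4 / 2 - b1 / 2 + hε * ‖e''‖ ^ 2 / 2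
  have b3 : ⟪e', e''⟫ = 0 := by linear_combination (h4 - ε * h3 - hε * ⟪e', e''⟫) / 2
  have b4 : ⟪e, e''⟫ = 0 := by rw [h3, b3, mul_zero]
  have hpos (u : Fin 3 → ℝ) (hu : u ≠ 0) : 0 < ‖A u‖ ^ 2 := by
    have : A u ≠ 0 := by simpa using hu
    have := norm_pos_iff.2 this
    positivity
  refine ⟨‖e‖ ^ 2, ‖e''‖ ^ 2, hpos _ fun h => ?_, hpos _ fun h => ?_, fun X Y => ?_⟩
  · simpa using congrFun h 0
  · simpa using congrFun h 2
  · have hv : φ X - φ Y = ![φ X 0 - φ Y 0, φ X 1 - φ Y 1, φ X 2 - φ Y 2] := by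
      ext i
      fin_cases i <;> simp
    rw [φ.dist_symm_eq, hv, hN, b1, b2, b3, b4]
    ring

end

/-! ### Local finiteness of orbits and the general facet bound. -/

lemma finite_setOf_mem_norm_le {L : Set (Fin 3 → ℝ)}
    (hL : ∀ m ∈ L, ∃ n : Fin 3 → ℤ, ∀ i, m i = n i / 2) (D : ℝ) : {m ∈ L | ‖m‖ ≤ D}.Finite := by
  refine ((Set.finite_Icc (fun _ : Fin 3 => -⌈2 * D⌉) (fun _ => ⌈2 * D⌉)).image
    fun n i => (n i : ℝ) / 2).subset ?_
  rintro m ⟨hm, hD⟩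
  obtain ⟨n, hn⟩ := hL m hm
  have hle (i : Fin 3) : -⌈2 * D⌉ ≤ n i ∧ n i ≤ ⌈2 * D⌉ := by
    have h1 := abs_le.1 ((norm_le_pi_norm m i).trans hD)
    have h2 := Int.le_ceil (2 * D)
    rw [hn] at h1
    constructor <;> rify <;> linarith
  exact ⟨n, ⟨fun i => (hle i).1, fun i => (hle i).2⟩, funext fun i => (hn i).symm⟩

lemma finite_pointOrbit_dist_le {G : Subgroup (Space ≃ᵃⁱ[ℝ] Space)}
    {W : Set (ℝ → ℝ → ℝ → Fin 3 → ℝ)} {L : Set (Fin 3 → ℝ)} (φ : Space ≃ᵃ[ℝ] (Fin 3 → ℝ))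
    (hG : ∀ g ∈ G, φ ∘ g ∘ φ.symm ∈ symmetryMaps L W) (hW : W.Finite)
    (hL : ∀ m ∈ L, ∃ n : Fin 3 → ℤ, ∀ i, m i = n i / 2) (P X : Space) (r : ℝ) :
    {Q ∈ pointOrbit G P | dist X Q ≤ r}.Finite := by
  have hφ : Continuous φ := φ.toAffineMap.continuous_of_finiteDimensional
  obtain ⟨C, hC⟩ := ((isCompact_closedBall X r).image hφ).isBounded.exists_norm_le
  refine (hW.biUnion fun w _ => (finite_setOf_mem_norm_le hL
    (C + ‖w (φ P 0) (φ P 1) (φ P 2)‖)).image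
      fun m => φ.symm (w (φ P 0) (φ P 1) (φ P 2) + m)).subset ?_
  rintro _ ⟨⟨g, hg, rfl⟩, hd⟩
  obtain ⟨w, hw, m, hm, h⟩ := hG g hg
  have hP := h (φ P)
  simp only [Function.comp_apply, AffineEquiv.symm_apply_apply] at hP
  refine Set.mem_biUnion hw ⟨m, ⟨hm, ?_⟩, by simp only [← hP, φ.symm_apply_apply]⟩
  have h1 := hC _ ⟨g P, by rwa [Metric.mem_closedBall, dist_comm], rfl⟩
  rw [eq_sub_of_add_eq' hP.symm]
  exact (norm_sub_le _ _).trans (by gcongr)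

/-- Coordinates as a horizontal part, relative to the origin `(s, t)`, and a height. -/
noncomputable def splitCoords (φ : Space ≃ᵃ[ℝ] (Fin 3 → ℝ)) (s t : ℝ) (X : Space) : (ℝ × ℝ) × ℝ :=
  ((φ X 0 - s, φ X 1 - t), φ X 2)

lemma splitCoords_injective (φ : Space ≃ᵃ[ℝ] (Fin 3 → ℝ)) (s t : ℝ) :
    Function.Injective (splitCoords φ s t) := by
  intro X Y h
  simp only [splitCoords, Prod.mk.injEq, sub_left_inj] at h
  refine φ.injective (funext fun i => ?_)
  fin_cases i
  exacts [h.1.1, h.1.2, h.2]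

/-- Bound on the facets of the stereohedra of a group with the horizontal subgroup `pgg` centred
at `(s, t)`, given the list of the other layers of an orbit. -/
theorem numFacets_dirichletStereohedron_le {G : Subgroup (Space ≃ᵃⁱ[ℝ] Space)}
    {W : Set (ℝ → ℝ → ℝ → Fin 3 → ℝ)} {L : Set (Fin 3 → ℝ)} (hG : IsOfType G (symmetryMaps L W))
    (hW : W.Finite) (hL : ∀ m ∈ L, ∃ n : Fin 3 → ℤ, ∀ i, m i = n i / 2) {ε : ℝ} (hε : ε * ε = 1)
    (v : Fin 3 → ℝ) (hrot : (fun p : Fin 3 → ℝ => ![-p 1, p 0, ε * p 2] + v) ∈ symmetryMaps L W) (s t : ℝ)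
    (hpgg : ∀ m n k : ℤ,
      (fun p : Fin 3 → ℝ => ![p 0 + m, p 1 + n, p 2 + k]) ∈ symmetryMaps L W ∧
      (fun p : Fin 3 → ℝ => ![2 * s - p 0 + m, 2 * t - p 1 + n, p 2 + k]) ∈ symmetryMaps L W ∧
      (fun p : Fin 3 → ℝ => ![1 / 2 + 2 * s - p 0 + m, 1 / 2 + p 1 + n, p 2 + k]) ∈ symmetryMaps L W ∧
      (fun p : Fin 3 → ℝ => ![1 / 2 + p 0 + m, 1 / 2 + 2 * t - p 1 + n, p 2 + k]) ∈ symmetryMaps L W)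
    (l : ℝ → List Layer)
    (hl : ∀ x y z, ∀ w ∈ W, ∀ m ∈ L,
      ((w x y z 0 + m 0 - s, w x y z 1 + m 1 - t) ∈ pggOrbit (x - s, y - t) ∧
        ∃ k : ℤ, w x y z 2 + m 2 = z + k) ∨
      ∃ Λ ∈ l z, Λ.Mem ((x - s, y - t), z)
        ((w x y z 0 + m 0 - s, w x y z 1 + m 1 - t), w x y z 2 + m 2))
    (N : ℕ∞) (hN : ∀ z, 2 + 14 +
      ((l z).map fun Λ => 2 * overlapBound Λ.isSwap Λ.fst Λ.snd).sum ≤ N) (P : Space) :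
    numFacets (dirichletStereohedron G P) ≤ N := by
  obtain ⟨φ, hφ⟩ := hG
  have hmem (g) (hg : g ∈ G) : φ ∘ g ∘ φ.symm ∈ symmetryMaps L W := hφ ▸ ⟨g, hg, rfl⟩
  have hex (f) (hf : f ∈ symmetryMaps L W) : ∃ g ∈ G, ∀ X, φ (g X) = f (φ X) := by
    rw [← hφ] at hf
    obtain ⟨g, hg, rfl⟩ := hf
    exact ⟨g, hg, fun X => by simp⟩
  obtain ⟨g₀, -, hg₀⟩ := hex _ hrot
  obtain ⟨a, c, ha, hc, hdist⟩ := exists_dist_sq_eq φ hε v g₀ hg₀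
  set ψ := splitCoords φ s t
  have hψ (X Y : Space) : dist X Y ^ 2 = scaledSqd a c (ψ X) (ψ Y) := by
    simp only [hdist, scaledSqd, sqd, ψ, splitCoords]
    ring
  have hP : P ∈ pointOrbit G P := ⟨1, G.one_mem, rfl⟩
  have horb {Q : Space} (hQ : Q ∈ pointOrbit G P) {f} (hf : f ∈ symmetryMaps L W) :
      ∃ R ∈ pointOrbit G P, φ R = f (φ Q) := by
    obtain ⟨g, hg, rfl⟩ := hQ
    obtain ⟨g', hg', h⟩ := hex f hf
    exact ⟨g' (g P), ⟨g' * g, G.mul_mem hg' hg, rfl⟩, h _⟩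
  refine (numFacets_voronoiRegion_le fun X r =>
    finite_pointOrbit_dist_le φ hmem hW hL P X r).trans ?_
  rw [← (splitCoords_injective φ s t).encard_image]
  refine (Set.encard_le_encard (t := neighbours a c (ψ '' pointOrbit G P) (ψ P)) ?_).trans
    ((encard_neighbours_le ha hc (Set.mem_image_of_mem ψ hP) ?_ (l (φ P 2)) ?_).trans (hN _))
  · rintro _ ⟨Q, ⟨hQ, hQP, X, heq, hlt⟩, rfl⟩
    refine ⟨⟨Q, hQ, rfl⟩, (splitCoords_injective φ s t).ne hQP, ψ X, ?_, ?_⟩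
    · rw [← hψ, ← hψ, heq]
    · rintro _ ⟨R, hR, rfl⟩ hRP hRQ
      rw [← hψ, ← hψ]
      exact pow_lt_pow_left₀ (hlt R hR (fun h => hRP (h ▸ rfl)) fun h => hRQ (h ▸ rfl))
        dist_nonneg two_ne_zero
  · rintro _ ⟨Q, hQ, rfl⟩ r ⟨m, n, hr⟩ k
    obtain ⟨h1, h2, h3, h4⟩ := hpgg m n k
    rcases hr with rfl | rfl | rfl | rfl
    · obtain ⟨R, hR, h⟩ := horb hQ h1
      exact ⟨R, hR, by ext <;> simp [ψ, splitCoords, h] <;> ring⟩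
    · obtain ⟨R, hR, h⟩ := horb hQ h2
      exact ⟨R, hR, by ext <;> simp [ψ, splitCoords, h] <;> ring⟩
    · obtain ⟨R, hR, h⟩ := horb hQ h3
      exact ⟨R, hR, by ext <;> simp [ψ, splitCoords, h] <;> ring⟩
    · obtain ⟨R, hR, h⟩ := horb hQ h4
      exact ⟨R, hR, by ext <;> simp [ψ, splitCoords, h] <;> ring⟩
  · rintro _ ⟨_, ⟨g, hg, rfl⟩, rfl⟩
    obtain ⟨w, hw, m, hm, h⟩ := hmem g hg
    have h' := h (φ P)
    simp only [Function.comp_apply, AffineEquiv.symm_apply_apply] at h'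
    simpa only [ψ, splitCoords, h', Pi.add_apply] using hl (φ P 0) (φ P 1) (φ P 2) w hw m hm

/-! ### The four types of groups -/

lemma latticeP_half {m : Fin 3 → ℝ} (hm : m ∈ latticeP) :
    ∃ n : Fin 3 → ℤ, ∀ i, m i = n i / 2 := by
  obtain ⟨n, hn⟩ := hm
  exact ⟨fun i => 2 * n i, fun i => by rw [hn]; push_cast; ring⟩

lemma latticeI_half {m : Fin 3 → ℝ} (hm : m ∈ latticeI) :
    ∃ n : Fin 3 → ℤ, ∀ i, m i = n i / 2 := by
  obtain hm | ⟨n, hn⟩ := hm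
  · exact latticeP_half hm
  · exact ⟨fun i => 2 * n i + 1, fun i => by rw [hn]; push_cast; ring⟩

lemma finite_withInversion {W : Set (ℝ → ℝ → ℝ → Fin 3 → ℝ)} (hW : W.Finite) :
    (withInversion W).Finite :=
  hW.union ((hW.image fun w x y z => -w x y z).subset
    fun _ ⟨w, hw, h⟩ => ⟨w, hw, h.symm⟩)

lemma mem_symmetryMaps {L : Set (Fin 3 → ℝ)} {W : Set (ℝ → ℝ → ℝ → Fin 3 → ℝ)}
    {w : ℝ → ℝ → ℝ → Fin 3 → ℝ} (hw : w ∈ W) {m : Fin 3 → ℝ} (hm : m ∈ L)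
    {f : (Fin 3 → ℝ) → Fin 3 → ℝ} (h0 : ∀ p, f p 0 = w (p 0) (p 1) (p 2) 0 + m 0)
    (h1 : ∀ p, f p 1 = w (p 0) (p 1) (p 2) 1 + m 1)
    (h2 : ∀ p, f p 2 = w (p 0) (p 1) (p 2) 2 + m 2) : f ∈ symmetryMaps L W := by
  refine ⟨w, hw, m, hm, fun p => funext fun i => ?_⟩
  fin_cases i
  exacts [h0 p, h1 p, h2 p]

lemma intVec_mem_latticeP (a b c : ℤ) : ![(a : ℝ), b, c] ∈ latticeP :=
  ⟨![a, b, c], fun i => by fin_cases i <;> rfl⟩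

lemma intVec_mem_latticeI (a b c : ℤ) : ![(a : ℝ), b, c] ∈ latticeI :=
  .inl (intVec_mem_latticeP a b c)

lemma halfVec_mem_latticeI (a b c : ℤ) : ![(a : ℝ) + 1 / 2, b + 1 / 2, c + 1 / 2] ∈ latticeI :=
  .inr ⟨![a, b, c], fun i => by fin_cases i <;> rfl⟩

theorem numFacets_le_of_typeI41cd {G : Subgroup (Space ≃ᵃⁱ[ℝ] Space)}
    (hG : IsOfType G typeI41cd) (P : Space) : numFacets (dirichletStereohedron G P) ≤ 44 := by
  -- Centring gives the layer at height `1/2`; the fourfold screw rotation, without and with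
  -- centring, gives those at `1/4` and `3/4`.
  refine numFacets_dirichletStereohedron_le hG (Set.toFinite _)
    (fun _ => latticeI_half) (ε := 1) (by norm_num) ![0, 1 / 2, 1 / 4] ?_ 0 0
    (fun m n k => ⟨?_, ?_, ?_, ?_⟩)
    (fun _ => [⟨false, 1, 1, 1 / 2⟩, ⟨true, 1, 0, 1 / 4⟩, ⟨true, 0, 1, 3 / 4⟩]) ?_ 44 ?_ P
  · exact mem_symmetryMaps (.inr (.inr (.inl rfl))) (intVec_mem_latticeI 0 0 0)
      (fun _ => by simp) (fun _ => by simp) (fun _ => by simp)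
  · exact mem_symmetryMaps (.inl rfl) (intVec_mem_latticeI m n k)
      (fun _ => by simp) (fun _ => by simp) (fun _ => by simp)
  · exact mem_symmetryMaps (.inr (.inl rfl)) (halfVec_mem_latticeI (m - 1) (n - 1) (k - 1))
      (fun _ => by simp <;> ring) (fun _ => by simp <;> ring) (fun _ => by simp <;> ring)
  · exact mem_symmetryMaps (.inr (.inr (.inr (.inr (.inr (.inl rfl)))))) (intVec_mem_latticeI m n k)
      (fun _ => by simp <;> ring) (fun _ => by simp <;> ring) (fun _ => by simp)
  · exact mem_symmetryMaps (.inr (.inr (.inr (.inr (.inl rfl))))) (halfVec_mem_latticeI m n (k - 1))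
      (fun _ => by simp <;> ring) (fun _ => by simp <;> ring) (fun _ => by simp <;> ring)
  · rintro x y z w (rfl | rfl | rfl | rfl | rfl | rfl | rfl | rfl)
      m (⟨n, hn⟩ | ⟨n, hn⟩)
    · exact .inl ⟨⟨n 0, n 1, .inl (by ext <;> simp [hn])⟩, n 2, by simp [hn]⟩
    · exact .inr ⟨⟨false, 1, 1, 1 / 2⟩, by simp,
        ⟨n 0, n 1, .inl (by ext <;> simp [hn, cosetRep] <;> ring)⟩, n 2, by simp [hn] <;> ring⟩
    · exact .inr ⟨⟨false, 1, 1, 1 / 2⟩, by simp,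
        ⟨n 0 + 1, n 1 + 1, .inr (.inl (by ext <;> simp [hn, cosetRep] <;> ring))⟩, n 2,
          by simp [hn]⟩
    · exact .inl ⟨⟨n 0 + 1, n 1 + 1, .inr (.inl (by ext <;> simp [hn] <;> ring))⟩, n 2 + 1,
        by simp [hn] <;> ring⟩
    · exact .inr ⟨⟨true, 1, 0, 1 / 4⟩, by simp,
        ⟨n 0, n 1, .inr (.inr (.inl (by ext <;> simp [hn, cosetRep] <;> ring)))⟩, n 2, by simp [hn]⟩
    · exact .inr ⟨⟨true, 0, 1, 3 / 4⟩, by simp,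
        ⟨n 0, n 1, .inr (.inr (.inl (by ext <;> simp [hn, cosetRep] <;> ring)))⟩, n 2,
          by simp [hn] <;> ring⟩
    · exact .inr ⟨⟨true, 0, 1, 3 / 4⟩, by simp,
        ⟨n 0, n 1, .inr (.inr (.inr (by ext <;> simp [hn, cosetRep] <;> ring)))⟩, n 2, by simp [hn]⟩
    · exact .inr ⟨⟨true, 1, 0, 1 / 4⟩, by simp,
        ⟨n 0, n 1, .inr (.inr (.inr (by ext <;> simp [hn, cosetRep] <;> ring)))⟩, n 2 + 1,
          by simp [hn] <;> ring⟩
    · exact .inr ⟨⟨false, 1, 1, 1 / 2⟩, by simp,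
        ⟨n 0 - 1, n 1, .inr (.inr (.inr (by ext <;> simp [hn, cosetRep] <;> ring)))⟩, n 2,
          by simp [hn]⟩
    · exact .inl ⟨⟨n 0, n 1, .inr (.inr (.inr (by ext <;> simp [hn] <;> ring)))⟩, n 2 + 1,
        by simp [hn] <;> ring⟩
    · exact .inl ⟨⟨n 0, n 1, .inr (.inr (.inl (by ext <;> simp [hn] <;> ring)))⟩, n 2, by simp [hn]⟩
    · exact .inr ⟨⟨false, 1, 1, 1 / 2⟩, by simp,
        ⟨n 0 + 1, n 1, .inr (.inr (.inl (by ext <;> simp [hn, cosetRep] <;> ring)))⟩, n 2,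
          by simp [hn] <;> ring⟩
    · exact .inr ⟨⟨true, 0, 1, 3 / 4⟩, by simp,
        ⟨n 0, n 1 + 1, .inr (.inl (by ext <;> simp [hn, cosetRep] <;> ring))⟩, n 2, by simp [hn]⟩
    · exact .inr ⟨⟨true, 1, 0, 1 / 4⟩, by simp,
        ⟨n 0 + 1, n 1 + 1, .inr (.inl (by ext <;> simp [hn, cosetRep] <;> ring))⟩, n 2 + 1,
          by simp [hn] <;> ring⟩
    · exact .inr ⟨⟨true, 1, 0, 1 / 4⟩, by simp,
        ⟨n 0, n 1, .inl (by ext <;> simp [hn, cosetRep])⟩, n 2, by simp [hn]⟩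
    · exact .inr ⟨⟨true, 0, 1, 3 / 4⟩, by simp,
        ⟨n 0 + 1, n 1, .inl (by ext <;> simp [hn, cosetRep] <;> ring)⟩, n 2, by simp [hn] <;> ring⟩
  -- `2 + 14 + 2 * (4 + 5 + 5) = 44`.
  · intro z
    norm_num [overlapBound]

theorem numFacets_le_of_typeI4barc2 {G : Subgroup (Space ≃ᵃⁱ[ℝ] Space)}
    (hG : IsOfType G typeI4barc2) (P : Space) : numFacets (dirichletStereohedron G P) ≤ 44 := by
  -- Elements reversing the vertical axis send height `z` to `-z` plus a constant, hence the offsets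
  -- `-2 * z` and `-2 * z + 1 / 2`.
  refine numFacets_dirichletStereohedron_le hG (Set.toFinite _)
    (fun _ => latticeI_half) (ε := -1) (by norm_num) 0 ?_ 0 0
    (fun m n k => ⟨?_, ?_, ?_, ?_⟩)
    (fun z => [⟨false, 1, 1, 1 / 2⟩, ⟨true, 1, 1, -2 * z⟩, ⟨true, 0, 0, -2 * z + 1 / 2⟩]) ?_ 44 ?_ P
  · exact mem_symmetryMaps (.inr (.inr (.inr (.inl rfl)))) (intVec_mem_latticeI 0 0 0)
      (fun _ => by simp) (fun _ => by simp) (fun _ => by simp)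
  · exact mem_symmetryMaps (.inl rfl) (intVec_mem_latticeI m n k)
      (fun _ => by simp) (fun _ => by simp) (fun _ => by simp)
  · exact mem_symmetryMaps (.inr (.inl rfl)) (intVec_mem_latticeI m n k)
      (fun _ => by simp) (fun _ => by simp) (fun _ => by simp)
  · exact mem_symmetryMaps (.inr (.inr (.inr (.inr (.inr (.inl rfl))))))
      (halfVec_mem_latticeI m n (k - 1))
      (fun _ => by simp <;> ring) (fun _ => by simp <;> ring) (fun _ => by simp <;> ring)
  · exact mem_symmetryMaps (.inr (.inr (.inr (.inr (.inl rfl))))) (halfVec_mem_latticeI m n (k - 1))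
      (fun _ => by simp <;> ring) (fun _ => by simp <;> ring) (fun _ => by simp <;> ring)
  · rintro x y z w (rfl | rfl | rfl | rfl | rfl | rfl | rfl | rfl)
      m (⟨n, hn⟩ | ⟨n, hn⟩)
    · exact .inl ⟨⟨n 0, n 1, .inl (by ext <;> simp [hn])⟩, n 2, by simp [hn]⟩
    · exact .inr ⟨⟨false, 1, 1, 1 / 2⟩, by simp,
        ⟨n 0, n 1, .inl (by ext <;> simp [hn, cosetRep] <;> ring)⟩, n 2, by simp [hn] <;> ring⟩
    · exact .inl ⟨⟨n 0, n 1, .inr (.inl (by ext <;> simp [hn]))⟩, n 2, by simp [hn]⟩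
    · exact .inr ⟨⟨false, 1, 1, 1 / 2⟩, by simp,
        ⟨n 0 + 1, n 1 + 1, .inr (.inl (by ext <;> simp [hn, cosetRep] <;> ring))⟩, n 2,
          by simp [hn] <;> ring⟩
    · exact .inr ⟨⟨true, 1, 1, -2 * z⟩, by simp,
        ⟨n 0 - 1, n 1, .inr (.inr (.inr (by ext <;> simp [hn, cosetRep] <;> ring)))⟩, n 2,
          by simp [hn] <;> ring⟩
    · exact .inr ⟨⟨true, 0, 0, -2 * z + 1 / 2⟩, by simp,
        ⟨n 0, n 1, .inr (.inr (.inr (by ext <;> simp [hn, cosetRep] <;> ring)))⟩, n 2,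
          by simp [hn] <;> ring⟩
    · exact .inr ⟨⟨true, 1, 1, -2 * z⟩, by simp,
        ⟨n 0, n 1 - 1, .inr (.inr (.inl (by ext <;> simp [hn, cosetRep] <;> ring)))⟩, n 2,
          by simp [hn] <;> ring⟩
    · exact .inr ⟨⟨true, 0, 0, -2 * z + 1 / 2⟩, by simp,
        ⟨n 0, n 1, .inr (.inr (.inl (by ext <;> simp [hn, cosetRep] <;> ring)))⟩, n 2,
          by simp [hn] <;> ring⟩
    · exact .inr ⟨⟨false, 1, 1, 1 / 2⟩, by simp,
        ⟨n 0 - 1, n 1, .inr (.inr (.inr (by ext <;> simp [hn, cosetRep] <;> ring)))⟩, n 2,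
          by simp [hn]⟩
    · exact .inl ⟨⟨n 0, n 1, .inr (.inr (.inr (by ext <;> simp [hn] <;> ring)))⟩, n 2 + 1,
        by simp [hn] <;> ring⟩
    · exact .inr ⟨⟨false, 1, 1, 1 / 2⟩, by simp,
        ⟨n 0, n 1 - 1, .inr (.inr (.inl (by ext <;> simp [hn, cosetRep] <;> ring)))⟩, n 2,
          by simp [hn]⟩
    · exact .inl ⟨⟨n 0, n 1, .inr (.inr (.inl (by ext <;> simp [hn] <;> ring)))⟩, n 2 + 1,
        by simp [hn] <;> ring⟩
    · exact .inr ⟨⟨true, 0, 0, -2 * z + 1 / 2⟩, by simp,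
        ⟨n 0, n 1, .inl (by ext <;> simp [hn, cosetRep])⟩, n 2, by simp [hn] <;> ring⟩
    · exact .inr ⟨⟨true, 1, 1, -2 * z⟩, by simp,
        ⟨n 0, n 1, .inl (by ext <;> simp [hn, cosetRep] <;> ring)⟩, n 2 + 1, by simp [hn] <;> ring⟩
    · exact .inr ⟨⟨true, 0, 0, -2 * z + 1 / 2⟩, by simp,
        ⟨n 0, n 1, .inr (.inl (by ext <;> simp [hn, cosetRep]))⟩, n 2, by simp [hn] <;> ring⟩
    · exact .inr ⟨⟨true, 1, 1, -2 * z⟩, by simp,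
        ⟨n 0 + 1, n 1 + 1, .inr (.inl (by ext <;> simp [hn, cosetRep] <;> ring))⟩, n 2 + 1,
          by simp [hn] <;> ring⟩
  -- The list gives `2 + 14 + 2 * (4 + 4 + 4) = 40`.
  · intro z
    norm_num [overlapBound]

theorem numFacets_le_of_typeP42nbc {G : Subgroup (Space ≃ᵃⁱ[ℝ] Space)}
    (hG : IsOfType G typeP42nbc) (P : Space) : numFacets (dirichletStereohedron G P) ≤ 44 := by
  -- `(1/4, 1/4)` is the centre of the listed half-turn `(-x + 1/2, -y + 1/2, z)`.
  refine numFacets_dirichletStereohedron_le hG (finite_withInversion (Set.toFinite _))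
    (fun _ => latticeP_half) (ε := 1) (by norm_num) ![1 / 2, 0, 1 / 2] ?_ (1 / 4) (1 / 4)
    (fun m n k => ⟨?_, ?_, ?_, ?_⟩)
    (fun z => [⟨true, 1, 1, 1 / 2⟩, ⟨false, 1, 1, -2 * z⟩, ⟨true, 0, 0, -2 * z + 1 / 2⟩]) ?_ 44 ?_ P
  · exact mem_symmetryMaps (.inl (.inr (.inr (.inl rfl)))) (intVec_mem_latticeP 0 0 0)
      (fun _ => by simp) (fun _ => by simp) (fun _ => by simp)
  · exact mem_symmetryMaps (.inl (.inl rfl)) (intVec_mem_latticeP m n k)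
      (fun _ => by simp) (fun _ => by simp) (fun _ => by simp)
  · exact mem_symmetryMaps (.inl (.inr (.inl rfl))) (intVec_mem_latticeP m n k)
      (fun _ => by simp <;> ring) (fun _ => by simp <;> ring) (fun _ => by simp)
  · exact mem_symmetryMaps (.inr ⟨_, .inr (.inr (.inr (.inr (.inr (.inl rfl))))), rfl⟩)
      (intVec_mem_latticeP (m + 1) (n + 1) k)
      (fun _ => by simp <;> ring) (fun _ => by simp <;> ring) (fun _ => by simp)
  · exact mem_symmetryMaps (.inr ⟨_, .inr (.inr (.inr (.inr (.inl rfl)))), rfl⟩)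
      (intVec_mem_latticeP (m + 1) (n + 1) k)
      (fun _ => by simp <;> ring) (fun _ => by simp <;> ring) (fun _ => by simp)
  · rintro x y z w ((rfl | rfl | rfl | rfl | rfl | rfl | rfl | rfl) |
      ⟨_, (rfl | rfl | rfl | rfl | rfl | rfl | rfl | rfl), rfl⟩) m ⟨n, hn⟩
    · exact .inl ⟨⟨n 0, n 1, .inl (by ext <;> simp [hn] <;> ring)⟩, n 2, by simp [hn]⟩
    · exact .inl ⟨⟨n 0, n 1, .inr (.inl (by ext <;> simp [hn] <;> ring))⟩, n 2, by simp [hn]⟩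
    · exact .inr ⟨⟨true, 1, 1, 1 / 2⟩, by simp,
        ⟨n 0, n 1 - 1, .inr (.inr (.inl (by ext <;> simp [hn, cosetRep] <;> ring)))⟩, n 2,
          by simp [hn]⟩
    · exact .inr ⟨⟨true, 1, 1, 1 / 2⟩, by simp,
        ⟨n 0 - 1, n 1, .inr (.inr (.inr (by ext <;> simp [hn, cosetRep] <;> ring)))⟩, n 2,
          by simp [hn]⟩
    · exact .inr ⟨⟨false, 1, 1, -2 * z⟩, by simp,
        ⟨n 0, n 1 - 1, .inr (.inr (.inl (by ext <;> simp [hn, cosetRep] <;> ring)))⟩, n 2,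
          by simp [hn] <;> ring⟩
    · exact .inr ⟨⟨false, 1, 1, -2 * z⟩, by simp,
        ⟨n 0 - 1, n 1, .inr (.inr (.inr (by ext <;> simp [hn, cosetRep] <;> ring)))⟩, n 2,
          by simp [hn] <;> ring⟩
    · exact .inr ⟨⟨true, 0, 0, -2 * z + 1 / 2⟩, by simp,
        ⟨n 0, n 1, .inl (by ext <;> simp [hn, cosetRep] <;> ring)⟩, n 2, by simp [hn] <;> ring⟩
    · exact .inr ⟨⟨true, 0, 0, -2 * z + 1 / 2⟩, by simp,
        ⟨n 0, n 1, .inr (.inl (by ext <;> simp [hn, cosetRep] <;> ring))⟩, n 2,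
          by simp [hn] <;> ring⟩
    · exact .inr ⟨⟨false, 1, 1, -2 * z⟩, by simp,
        ⟨n 0, n 1, .inr (.inl (by ext <;> simp [hn, cosetRep] <;> ring))⟩, n 2,
          by simp [hn] <;> ring⟩
    · exact .inr ⟨⟨false, 1, 1, -2 * z⟩, by simp,
        ⟨n 0 - 1, n 1 - 1, .inl (by ext <;> simp [hn, cosetRep] <;> ring)⟩, n 2,
          by simp [hn] <;> ring⟩
    · exact .inr ⟨⟨true, 0, 0, -2 * z + 1 / 2⟩, by simp,
        ⟨n 0 - 1, n 1 - 1, .inr (.inr (.inr (by ext <;> simp [hn, cosetRep] <;> ring)))⟩, n 2 - 1,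
          by simp [hn] <;> ring⟩
    · exact .inr ⟨⟨true, 0, 0, -2 * z + 1 / 2⟩, by simp,
        ⟨n 0 - 1, n 1 - 1, .inr (.inr (.inl (by ext <;> simp [hn, cosetRep] <;> ring)))⟩, n 2 - 1,
          by simp [hn] <;> ring⟩
    · exact .inl ⟨⟨n 0 - 1, n 1 - 1, .inr (.inr (.inr (by ext <;> simp [hn] <;> ring)))⟩, n 2,
        by simp [hn]⟩
    · exact .inl ⟨⟨n 0 - 1, n 1 - 1, .inr (.inr (.inl (by ext <;> simp [hn] <;> ring)))⟩, n 2,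
        by simp [hn]⟩
    · exact .inr ⟨⟨true, 1, 1, 1 / 2⟩, by simp,
        ⟨n 0, n 1, .inr (.inl (by ext <;> simp [hn, cosetRep] <;> ring))⟩, n 2 - 1,
          by simp [hn] <;> ring⟩
    · exact .inr ⟨⟨true, 1, 1, 1 / 2⟩, by simp,
        ⟨n 0 - 1, n 1 - 1, .inl (by ext <;> simp [hn, cosetRep] <;> ring)⟩, n 2 - 1,
          by simp [hn] <;> ring⟩
  -- Again the list gives `40`.
  · intro z
    norm_num [overlapBound]

theorem numFacets_le_of_typeI41acd {G : Subgroup (Space ≃ᵃⁱ[ℝ] Space)}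
    (hG : IsOfType G typeI41acd) (P : Space) : numFacets (dirichletStereohedron G P) ≤ 94 := by
  -- The listed `(-x + 1/2, -y, z + 1/2)` followed by the lattice translation `(-1/2, 1/2, -1/2)` is
  -- a half-turn about `(0, 1/4)`.
  refine numFacets_dirichletStereohedron_le hG (finite_withInversion (Set.toFinite _))
    (fun _ => latticeI_half) (ε := 1) (by norm_num) ![1 / 4, 3 / 4, 1 / 4] ?_ 0 (1 / 4)
    (fun m n k => ⟨?_, ?_, ?_, ?_⟩)
    (fun z => [⟨true, 1, 0, 1 / 4⟩, ⟨false, 1, 1, 1 / 2⟩, ⟨true, 0, 1, 3 / 4⟩, ⟨false, 0, 1, -2 * z⟩,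
      ⟨false, 1, 0, -2 * z + 1 / 2⟩, ⟨true, 1, 1, -2 * z + 3 / 4⟩, ⟨true, 0, 0, -2 * z + 1 / 4⟩]) ?_ 94 ?_ P
  · exact mem_symmetryMaps (.inl (.inr (.inr (.inl rfl)))) (intVec_mem_latticeI 0 0 0)
      (fun _ => by simp) (fun _ => by simp) (fun _ => by simp)
  · exact mem_symmetryMaps (.inl (.inl rfl)) (intVec_mem_latticeI m n k)
      (fun _ => by simp) (fun _ => by simp) (fun _ => by simp)
  · exact mem_symmetryMaps (.inl (.inr (.inl rfl))) (halfVec_mem_latticeI (m - 1) n (k - 1))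
      (fun _ => by simp <;> ring) (fun _ => by simp <;> ring) (fun _ => by simp <;> ring)
  · exact mem_symmetryMaps (.inr ⟨_, .inr (.inr (.inr (.inr (.inr (.inl rfl))))), rfl⟩)
      (halfVec_mem_latticeI m n k)
      (fun _ => by simp <;> ring) (fun _ => by simp <;> ring) (fun _ => by simp <;> ring)
  · exact mem_symmetryMaps (.inr ⟨_, .inr (.inr (.inr (.inr (.inl rfl)))), rfl⟩)
      (intVec_mem_latticeI (m + 1) (n + 1) k)
      (fun _ => by simp <;> ring) (fun _ => by simp <;> ring) (fun _ => by simp)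
  · rintro x y z w ((rfl | rfl | rfl | rfl | rfl | rfl | rfl | rfl) |
      ⟨_, (rfl | rfl | rfl | rfl | rfl | rfl | rfl | rfl), rfl⟩) m (⟨n, hn⟩ | ⟨n, hn⟩)
    · exact .inl ⟨⟨n 0, n 1, .inl (by ext <;> simp [hn] <;> ring)⟩, n 2, by simp [hn]⟩
    · exact .inr ⟨⟨false, 1, 1, 1 / 2⟩, by simp,
        ⟨n 0, n 1, .inl (by ext <;> simp [hn, cosetRep] <;> ring)⟩, n 2, by simp [hn] <;> ring⟩
    · exact .inr ⟨⟨false, 1, 1, 1 / 2⟩, by simp,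
        ⟨n 0 + 1, n 1, .inr (.inl (by ext <;> simp [hn, cosetRep] <;> ring))⟩, n 2, by simp [hn]⟩
    · exact .inl ⟨⟨n 0 + 1, n 1, .inr (.inl (by ext <;> simp [hn] <;> ring))⟩, n 2 + 1,
        by simp [hn] <;> ring⟩
    · exact .inr ⟨⟨true, 1, 0, 1 / 4⟩, by simp,
        ⟨n 0, n 1, .inr (.inr (.inl (by ext <;> simp [hn, cosetRep] <;> ring)))⟩, n 2, by simp [hn]⟩
    · exact .inr ⟨⟨true, 0, 1, 3 / 4⟩, by simp,
        ⟨n 0, n 1, .inr (.inr (.inl (by ext <;> simp [hn, cosetRep] <;> ring)))⟩, n 2,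
          by simp [hn] <;> ring⟩
    · exact .inr ⟨⟨true, 0, 1, 3 / 4⟩, by simp,
        ⟨n 0, n 1, .inr (.inr (.inr (by ext <;> simp [hn, cosetRep] <;> ring)))⟩, n 2, by simp [hn]⟩
    · exact .inr ⟨⟨true, 1, 0, 1 / 4⟩, by simp,
        ⟨n 0, n 1, .inr (.inr (.inr (by ext <;> simp [hn, cosetRep] <;> ring)))⟩, n 2 + 1,
          by simp [hn] <;> ring⟩
    · exact .inr ⟨⟨false, 0, 1, -2 * z⟩, by simp,
        ⟨n 0, n 1 - 1, .inr (.inr (.inl (by ext <;> simp [hn, cosetRep] <;> ring)))⟩, n 2,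
          by simp [hn] <;> ring⟩
    · exact .inr ⟨⟨false, 1, 0, -2 * z + 1 / 2⟩, by simp,
        ⟨n 0 + 1, n 1, .inr (.inr (.inl (by ext <;> simp [hn, cosetRep] <;> ring)))⟩, n 2,
          by simp [hn] <;> ring⟩
    · exact .inr ⟨⟨false, 1, 0, -2 * z + 1 / 2⟩, by simp,
        ⟨n 0 - 1, n 1 - 1, .inr (.inr (.inr (by ext <;> simp [hn, cosetRep] <;> ring)))⟩, n 2,
          by simp [hn] <;> ring⟩
    · exact .inr ⟨⟨false, 0, 1, -2 * z⟩, by simp,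
        ⟨n 0, n 1, .inr (.inr (.inr (by ext <;> simp [hn, cosetRep] <;> ring)))⟩, n 2 + 1,
          by simp [hn] <;> ring⟩
    · exact .inr ⟨⟨true, 1, 1, -2 * z + 3 / 4⟩, by simp,
        ⟨n 0, n 1, .inl (by ext <;> simp [hn, cosetRep] <;> ring)⟩, n 2, by simp [hn] <;> ring⟩
    · exact .inr ⟨⟨true, 0, 0, -2 * z + 1 / 4⟩, by simp,
        ⟨n 0 + 1, n 1 + 1, .inl (by ext <;> simp [hn, cosetRep] <;> ring)⟩, n 2 + 1,
          by simp [hn] <;> ring⟩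
    · exact .inr ⟨⟨true, 0, 0, -2 * z + 1 / 4⟩, by simp,
        ⟨n 0, n 1, .inr (.inl (by ext <;> simp [hn, cosetRep] <;> ring))⟩, n 2,
          by simp [hn] <;> ring⟩
    · exact .inr ⟨⟨true, 1, 1, -2 * z + 3 / 4⟩, by simp,
        ⟨n 0 + 1, n 1 + 1, .inr (.inl (by ext <;> simp [hn, cosetRep] <;> ring))⟩, n 2,
          by simp [hn] <;> ring⟩
    · exact .inr ⟨⟨false, 0, 1, -2 * z⟩, by simp,
        ⟨n 0, n 1, .inr (.inl (by ext <;> simp [hn, cosetRep] <;> ring))⟩, n 2,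
          by simp [hn] <;> ring⟩
    · exact .inr ⟨⟨false, 1, 0, -2 * z + 1 / 2⟩, by simp,
        ⟨n 0 + 1, n 1, .inr (.inl (by ext <;> simp [hn, cosetRep] <;> ring))⟩, n 2,
          by simp [hn] <;> ring⟩
    · exact .inr ⟨⟨false, 1, 0, -2 * z + 1 / 2⟩, by simp,
        ⟨n 0 - 1, n 1, .inl (by ext <;> simp [hn, cosetRep] <;> ring)⟩, n 2 - 1,
          by simp [hn] <;> ring⟩
    · exact .inr ⟨⟨false, 0, 1, -2 * z⟩, by simp,
        ⟨n 0, n 1, .inl (by ext <;> simp [hn, cosetRep] <;> ring)⟩, n 2, by simp [hn] <;> ring⟩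
    · exact .inr ⟨⟨true, 1, 1, -2 * z + 3 / 4⟩, by simp,
        ⟨n 0 - 1, n 1 - 1, .inr (.inr (.inr (by ext <;> simp [hn, cosetRep] <;> ring)))⟩, n 2 - 1,
          by simp [hn] <;> ring⟩
    · exact .inr ⟨⟨true, 0, 0, -2 * z + 1 / 4⟩, by simp,
        ⟨n 0, n 1 - 1, .inr (.inr (.inr (by ext <;> simp [hn, cosetRep] <;> ring)))⟩, n 2,
          by simp [hn] <;> ring⟩
    · exact .inr ⟨⟨true, 0, 0, -2 * z + 1 / 4⟩, by simp,
        ⟨n 0 - 1, n 1 - 1, .inr (.inr (.inl (by ext <;> simp [hn, cosetRep] <;> ring)))⟩, n 2 - 1,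
          by simp [hn] <;> ring⟩
    · exact .inr ⟨⟨true, 1, 1, -2 * z + 3 / 4⟩, by simp,
        ⟨n 0, n 1 - 1, .inr (.inr (.inl (by ext <;> simp [hn, cosetRep] <;> ring)))⟩, n 2 - 1,
          by simp [hn] <;> ring⟩
    · exact .inl ⟨⟨n 0 - 1, n 1 - 1, .inr (.inr (.inr (by ext <;> simp [hn] <;> ring)))⟩, n 2,
        by simp [hn]⟩
    · exact .inr ⟨⟨false, 1, 1, 1 / 2⟩, by simp,
        ⟨n 0 - 1, n 1, .inr (.inr (.inr (by ext <;> simp [hn, cosetRep] <;> ring)))⟩, n 2,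
          by simp [hn] <;> ring⟩
    · exact .inr ⟨⟨false, 1, 1, 1 / 2⟩, by simp,
        ⟨n 0, n 1 - 1, .inr (.inr (.inl (by ext <;> simp [hn, cosetRep] <;> ring)))⟩, n 2 - 1,
          by simp [hn] <;> ring⟩
    · exact .inl ⟨⟨n 0, n 1, .inr (.inr (.inl (by ext <;> simp [hn] <;> ring)))⟩, n 2,
        by simp [hn] <;> ring⟩
    · exact .inr ⟨⟨true, 1, 0, 1 / 4⟩, by simp,
        ⟨n 0, n 1 - 1, .inr (.inl (by ext <;> simp [hn, cosetRep] <;> ring))⟩, n 2 - 1,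
          by simp [hn] <;> ring⟩
    · exact .inr ⟨⟨true, 0, 1, 3 / 4⟩, by simp,
        ⟨n 0, n 1, .inr (.inl (by ext <;> simp [hn, cosetRep] <;> ring))⟩, n 2 - 1,
          by simp [hn] <;> ring⟩
    · exact .inr ⟨⟨true, 0, 1, 3 / 4⟩, by simp,
        ⟨n 0, n 1 - 1, .inl (by ext <;> simp [hn, cosetRep] <;> ring)⟩, n 2 - 1,
          by simp [hn] <;> ring⟩
    · exact .inr ⟨⟨true, 1, 0, 1 / 4⟩, by simp,
        ⟨n 0, n 1, .inl (by ext <;> simp [hn, cosetRep] <;> ring)⟩, n 2, by simp [hn] <;> ring⟩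
  -- The list gives `2 + 14 + 2 * (5 + 4 + 5 + 7 + 7 + 4 + 4) = 88`.
  · intro z
    norm_num [overlapBound]

/-- Bounds on the number of facets of Dirichlet stereohedra for the four tetragonal groups
whose horizontal subgroup is of planar type `pgg`. -/
theorem mainTheorem12 :
    (∀ (G : Subgroup (Space ≃ᵃⁱ[ℝ] Space)) (P : Space),
      IsOfType G typeI41cd ∨ IsOfType G typeI4barc2 ∨ IsOfType G typeP42nbc →
        numFacets (dirichletStereohedron G P) ≤ 44) ∧
    (∀ (G : Subgroup (Space ≃ᵃⁱ[ℝ] Space)) (P : Space),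
      IsOfType G typeI41acd → numFacets (dirichletStereohedron G P) ≤ 94) :=
  ⟨fun _ P h => h.elim (numFacets_le_of_typeI41cd · P) fun h =>
    h.elim (numFacets_le_of_typeI4barc2 · P) (numFacets_le_of_typeP42nbc · P),
   fun _ P h => numFacets_le_of_typeI41acd h P⟩
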